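/- **Model.** A network is a finite simple connected undirected graph $G$ with $n\ge 1$ nodes and maximum degree $\Delta$. In each synchronous round every node either transmits a finite binary string to all its neighbours or listens; a listening node receives a message iff exactly one of its neighbours transmits, and otherwise it hears nothing (collisions are not detectable). The nodes' local clocks run at the same speed but may start at arbitrary different rounds (a node's clock starts at the latest when it receives its first message). A universal deterministic distributed algorithm determines a node's action, and the set of source messages the node possesses, only from the node's history: its label, its source message (if any), and what it received in each round since its clock started. $k$-broadcast with distinct sources $s_1,\dots,s_k$ holding binary strings $\mu_1,\dots,\mu_k$ is solved if from some round on every node possesses exactly the set $\{\mu_1,\dots,\mu_k\}$. The length of a labeling is the maximum length of a label. **Labeling scheme $\Lambda_{KB}$.** Choose an arbitrary node $r$ (the coordinator). Each label is a binary string $strat\cdot join\cdot stay\cdot ack\cdot sched$ whose first four components are single bits. * $join, stay, ack$: Let $DOM_1=\{r\}$ and $INF_1=\{r\}$. For $i\ge1$ let $FRONT_i$ be the set of nodes outside $INF_i$ with a neighbour in $INF_i$, let $NEW_i$ be the set of nodes of $FRONT_i$ with exactly one neighbour in $DOM_i$, let $INF_{i+1}=INF_i\cup NEW_i$, and let $DOM_{i+1}$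 be an inclusion-minimal subset of $DOM_i\cup NEW_i$ such that every node of $FRONT_{i+1}$ has a neighbour in it. A node has $join=1$ iff it is in some $DOM_i$. For each $i$ and each $v\in DOM_i\cap DOM_{i+1}$ one neighbour of $v$ in $NEW_i$ is chosen; exactly the chosen nodes have $stay=1$. Exactly one node, among those that enter the sets $INF_i$ last, has $ack=1$. Finally, at $r$ all three bits are set to $1$. * If $k\le\Delta$: $strat=0$ everywhere, $sched$ is the binary representation of $i$ at $s_i$, and the single bit $0$ at all non-sources. * If $k>\Delta$: $strat=1$ everywhere, and $sched$ is the $\lceil\log_2(c+1)\rceil$-bit binary representation of the node's colour in a greedy proper colouring (colours $1,2,\dots$, any node order) of $G^2$, the graph in which distinct nodes at distance at most $2$ in $G$ are adjacent; $c$ is the number of colours used. **Algorithm $\mathcal{KB}$.** *Broadcast* of a message from $r$: $r$ transmits it; a node that first receives it in round $t$ transmits "stay" in round $t+1$ if $stay=1$, and transmits the message in round $t+2$ if $join=1$; a node that transmitted the message in round $t$ and hears "stay" in round $t+1$ transmits the message again in round $t+2$. Broadcast messages carry $r$'s round number. *Acknowledgement*: an initiating node transmits an "ack" message carrying the number of the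 round in which it was informed; a node that hears an "ack" carrying the number of a round in which it itself transmitted the broadcast message forwards it with its own informed round number, until it reaches $r$. *Bounded acknowledged broadcast*: broadcast a message; the node labeled $join\,stay\,ack=001$ starts an acknowledgement directly after being informed, attaching the current round number $m$; on receiving it, $r$ broadcasts $m$; everything ends in round $3m$. 1. *Initialize*: a bounded acknowledged broadcast of "init" from $r$. 2. *Aggregate*, $strat=0$: phases of $2m$ rounds. In the $i$-th phase $r$ broadcasts $i$, and in round $m+1$ of the phase the node with $sched=i$ starts an acknowledgement that carries its source message (if this node is $r$, the phase counts as acknowledged). After the first phase that is not acknowledged, $r$ broadcasts "done" in one more phase (which the node labeled $001$ acknowledges), and the subroutine ends with that phase. *Aggregate*, $strat=1$: $m$ phases of $2^{|sched|}-1$ rounds; in the $i$-th round of each phase exactly the nodes with $sched=i$ transmit, and they transmit the set of source messages they possess. 3. *Inform*: a bounded acknowledged broadcast, from $r$, of the set of source messages $r$ possesses. A node possesses its own source message and those contained in messages it has received. **Theorem.** There is an absolute constant $C$ such that the following holds for every $n$-node network $G$ with maximum degree $\Delta$, every $k\in\{1,\dots,n\}$, all distinct sources $s_1,\dots,s_k$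 and every choice of the coordinator $r$. The scheme $\Lambda_{KB}$ produces a labeling of $G$, and for every labeling it can produce (whatever arbitrary choices it makes): * for all source messages $\mu_1,\dots,\mu_k$ (finite binary strings) and all starting rounds of the local clocks, executing $\mathcal{KB}$ on the labeled network solves $k$-broadcast; * the length of the labeling is at most $C\,(1+\min\{\log_2 k,\log_2\Delta\})$ (read $\log_2\Delta$ as $0$ if $\Delta=0$), i.e. $O(\min\{\log k,\log\Delta\})$ up to an additive constant; * if $k\le\Delta$, the $sched$ components of the $k$ sources are pairwise distinct; if $k>\Delta$, any two distinct nodes at distance at most two have different $sched$ components. -/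

import Mathlib

namespace RadioKB

/-! ### Radio networks, histories, deterministic distributed algorithms -/

/-- Finite binary strings. -/
abbrev Bits := List Bool

/-- A universal deterministic distributed algorithm. What a node does in a round (`none`: listen,
`some m`: transmit the string `m`), and which source messages it possesses, are functions of the
current history of the node: its label, its source message (if any), and what it received in each
round since its local clock started (`none`: it did not hear anything in that round). -/
structure Algorithm where
  act : Bits → Option Bits → List (Option Bits) → Option Bits
  possesses : Bits → Option Bits → List (Option Bits) → Finset Bits

open Classical in
/-- What `v` hears in a round in which the nodes choose the actions `tx`: the message of its unique
transmitting neighbour, if `v` listens and there is exactly one such neighbour; otherwise nothing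
(silence and collisions are indistinguishable). -/
noncomputable def hears {V : Type*} (G : SimpleGraph V) (tx : V → Option Bits) (v : V) :
    Option Bits :=
  if h : tx v = none ∧ ∃! w, G.Adj v w ∧ (tx w).isSome = true then tx h.2.choose else none

/-- The sequence of receptions in the local history of `v` before (global) round `t`, or `none` if
the local clock of `v` has not started yet. Local clocks need not agree: the clock of `v` starts in
round `wake v`, or as soon as `v` receives a message, if that happens earlier. A node
whose clock has not started listens. -/
noncomputable def history {V : Type*} (G : SimpleGraph V) (A : Algorithm) (lab : V → Bits)
    (src : V → Option Bits) (wake : V → ℕ) :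
    ℕ → V → Option (List (Option Bits))
  | 0, v => if wake v = 0 then some [] else none
  | t + 1, v =>
    let h := hears G
      (fun w => (history G A lab src wake t w).bind (A.act (lab w) (src w))) v
    match history G A lab src wake t v, h with
    | some H, _ => some (H ++ [h])
    | none, some m => some [some m]
    | none, none => if wake v ≤ t + 1 then some [] else none

section Model

variable {V : Type*} [Fintype V] [DecidableEq V] (G : SimpleGraph V) [DecidableRel G.Adj]

/-- The source message initially held by each node. -/
def sourceMessage {k : ℕ} (s : Fin k ↪ V) (μ : Fin k → Bits) (v : V) : Option Bits :=
  ((List.finRange k).find? (fun i => s i = v)).map μ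

/-- `A` solves `k`-broadcast on `G` labeled by `lab`, with sources `s`, source messages `μ` and
local clocks started according to `wake`: from some round on, each node possesses exactly the
complete set of source messages. -/
def Solves (A : Algorithm) (lab : V → Bits) {k : ℕ} (s : Fin k ↪ V) (μ : Fin k → Bits)
    (wake : V → ℕ) : Prop :=
  ∃ T, ∀ t ≥ T, ∀ v, ∃ H, history G A lab (sourceMessage s μ) wake t v = some H ∧
    A.possesses (lab v) (sourceMessage s μ v) H = Finset.univ.image μ

/-! ### The labeling scheme for acknowledged broadcast -/

/-- Nodes outside `I` with a neighbour in `I`. -/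
def frontier (I : Finset V) : Finset V :=
  Finset.univ.filter (fun v => v ∉ I ∧ ∃ u ∈ I, G.Adj u v)

/-- Nodes of the frontier of `I` that have exactly one neighbour in `D`. -/
def newly (I D : Finset V) : Finset V :=
  (frontier G I).filter (fun v => (D.filter (fun u => G.Adj u v)).card = 1)

/-- The nodes informed before stage `i` when exactly the set `dom j` transmits in stage `j`. -/
def informed (r : V) (dom : ℕ → Finset V) : ℕ → Finset V
  | 0 => {r}
  | i + 1 => informed r dom i ∪ newly G (informed r dom i) (dom i)

/-- The nodes first informed in stage `i`. -/
def newAt (r : V) (dom : ℕ → Finset V) (i : ℕ) : Finset V :=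
  newly G (informed G r dom i) (dom i)

/-- In stage `0` the start node transmits; the transmitting set of stage `i + 1` is an
inclusion-minimal subset of the nodes that transmitted, or were first informed, in stage `i`, among
those that dominate the current frontier. -/
structure IsDomSequence (r : V) (dom : ℕ → Finset V) : Prop where
  zero : dom 0 = {r}
  succ : ∀ i, Minimal (fun D : Finset V => D ⊆ dom i ∪ newAt G r dom i ∧
    ∀ v ∈ frontier G (informed G r dom (i + 1)), ∃ u ∈ D, G.Adj u v) (dom (i + 1))

/-- The bits `join`, `stay`, `ack` are assigned by the labeling scheme for acknowledged broadcast
with start node `r`: `join` marks the nodes of the transmitting sets; for each node `v` that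
transmits in stages `i` and `i + 1`, one neighbour of `v` first informed in stage `i` gets `stay`;
and `ack` marks one node that is informed last. -/
def IsAckLabeling (r : V) (join stay ack : V → Bool) : Prop :=
  ∃ (dom : ℕ → Finset V) (stayer : ℕ → V → V) (z : V),
    IsDomSequence G r dom ∧
    (∀ v, join v = true ↔ ∃ i, v ∈ dom i) ∧
    (∀ i, ∀ v ∈ dom i ∩ dom (i + 1), stayer i v ∈ newAt G r dom i ∧ G.Adj v (stayer i v)) ∧
    (∀ w, stay w = true ↔ ∃ i, ∃ v ∈ dom i ∩ dom (i + 1), stayer i v = w) ∧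
    (∀ i, z ∈ informed G r dom i → informed G r dom i = Finset.univ) ∧
    (∀ v, ack v = true ↔ v = z)

/-! ### The labeling scheme for `k`-broadcast -/

/-- The `L`-bit binary representation of `a` (least significant bit first). -/
def binary (L a : ℕ) : Bits := (List.range L).map (fun j => Nat.testBit a j)

/-- The square of `G`: distinct nodes are adjacent if they are at distance at most two in `G`. -/
def square (G : SimpleGraph V) : SimpleGraph V where
  Adj u v := u ≠ v ∧ (G.Adj u v ∨ ∃ w, G.Adj u w ∧ G.Adj w v)
  symm := ⟨fun _ _ h => ⟨h.1.symm,
    h.2.imp (fun a => a.symm) (fun ⟨w, a, b⟩ => ⟨w, b.symm, a.symm⟩)⟩⟩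
  loopless := ⟨fun _ h => h.1 rfl⟩

/-- `col` is the result of the greedy colouring algorithm with colours `1, 2, …` on the graph `H`,
when it processes the nodes in the order `order`. -/
def IsGreedyColouring (H : SimpleGraph V) (order : V ≃ Fin (Fintype.card V)) (col : V → ℕ) : Prop :=
  ∀ v, IsLeast {a : ℕ | 1 ≤ a ∧ ∀ u, H.Adj u v → order u < order v → col u ≠ a} (col v)

/-- The `sched` components assigned for the sources `s`. If `k ≤ Δ`, the sources get the binary
representations of `1, …, k`, and all other nodes the single bit `0`. If `k > Δ`, the nodes get the
colours of a greedy distance-two colouring, in binary with `⌈log₂ (c + 1)⌉` bits, where `c` is the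
number of colours used. -/
def IsSched {k : ℕ} (s : Fin k ↪ V) (sched : V → Bits) : Prop :=
  (k ≤ G.maxDegree →
    (∀ i : Fin k, sched (s i) = Nat.bits ((i : ℕ) + 1)) ∧
    (∀ v, (∀ i, s i ≠ v) → sched v = [false])) ∧
  (G.maxDegree < k →
    ∃ (order : V ≃ Fin (Fintype.card V)) (col : V → ℕ), IsGreedyColouring (square G) order col ∧
      ∀ v, sched v = binary (Nat.clog 2 ((Finset.univ.image col).card + 1)) (col v))

/-- `lab` is a labeling of `G` with sources `s`, produced by the labeling scheme for `k`-broadcast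
with coordinator `r`. The label of a node is the string `strat join stay ack sched`. The order in
which the greedy algorithm colours the nodes, the minimal dominating sets, and the marked nodes are
arbitrary choices of the scheme. -/
def IsKBLabeling {k : ℕ} (s : Fin k ↪ V) (r : V) (lab : V → Bits) : Prop :=
  ∃ (join stay ack : V → Bool) (sched : V → Bits),
    IsAckLabeling G r join stay ack ∧ IsSched G s sched ∧
    ∀ v, lab v = decide (G.maxDegree < k) ::
      (if v = r then true :: true :: true :: sched v
        else join v :: stay v :: ack v :: sched v)

end Model

/-! ### The algorithm for `k`-broadcast -/

/-- The messages `μ` that the coordinator disseminates with the broadcast algorithm. -/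
inductive Content where
  /-- the string "init" -/
  | init
  /-- the second broadcast of a bounded acknowledged broadcast: the value of `m` -/
  | bound (m : ℕ)
  /-- start of the `i`-th phase of the individual collection -/
  | query (i : ℕ)
  /-- end of the individual collection -/
  | done
  /-- a set of source messages -/
  | inform (K : Finset Bits)
  deriving DecidableEq

/-- The information attached to an "ack" message. -/
inductive AckBody where
  | plain
  | round (m : ℕ)
  | sourceMsg (μ : Bits)
  deriving DecidableEq

inductive Msg where
  /-- the broadcast message `c`, stamped with the round in which it is transmitted -/
  | data (c : Content) (t : ℕ)
  | stay
  /-- an acknowledgement, addressed to the node that transmitted in round `t` -/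
  | ack (t : ℕ) (b : AckBody)
  /-- the set of source messages known to the sender -/
  | known (K : Finset Bits)
  deriving DecidableEq

/-- The source messages that are contained in a message. -/
def Msg.contents : Msg → Finset Bits
  | .data (.inform K) _ => K
  | .ack _ (.sourceMsg μ) => {μ}
  | .known K => K
  | _ => ∅

abbrev ContentCode := (Unit ⊕ Unit) ⊕ (ℕ ⊕ ℕ) ⊕ Finset Bits
abbrev AckCode := Unit ⊕ ℕ ⊕ Bits
abbrev MsgCode := (ContentCode × ℕ) ⊕ Unit ⊕ (ℕ × AckCode) ⊕ Finset Bits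

def Content.toCode : Content → ContentCode
  | .init => .inl (.inl ())
  | .done => .inl (.inr ())
  | .bound m => .inr (.inl (.inl m))
  | .query i => .inr (.inl (.inr i))
  | .inform K => .inr (.inr K)

def Content.ofCode : ContentCode → Content
  | .inl (.inl _) => .init
  | .inl (.inr _) => .done
  | .inr (.inl (.inl m)) => .bound m
  | .inr (.inl (.inr i)) => .query i
  | .inr (.inr K) => .inform K

def AckBody.toCode : AckBody → AckCode
  | .plain => .inl ()
  | .round m => .inr (.inl m)
  | .sourceMsg μ => .inr (.inr μ)

def AckBody.ofCode : AckCode → AckBody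
  | .inl _ => .plain
  | .inr (.inl m) => .round m
  | .inr (.inr μ) => .sourceMsg μ

def Msg.toCode : Msg → MsgCode
  | .data c t => .inl (c.toCode, t)
  | .stay => .inr (.inl ())
  | .ack t b => .inr (.inr (.inl (t, b.toCode)))
  | .known K => .inr (.inr (.inr K))

def Msg.ofCode : MsgCode → Msg
  | .inl (c, t) => .data (Content.ofCode c) t
  | .inr (.inl _) => .stay
  | .inr (.inr (.inl (t, b))) => .ack t (AckBody.ofCode b)
  | .inr (.inr (.inr K)) => .known K

/-- Messages as finite binary strings. -/
def Msg.encode (x : Msg) : Bits := Computability.encodeNat (Encodable.encode x.toCode)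

def Msg.decode (b : Bits) : Option Msg :=
  (Encodable.decode (α := MsgCode) (Computability.decodeNat b)).map Msg.ofCode

theorem Msg.decode_encode (x : Msg) : Msg.decode x.encode = some x := by
  have h : Msg.ofCode x.toCode = x := by
    rcases x with ⟨c, t⟩ | _ | ⟨t, b⟩ | K
    · cases c <;> rfl
    · rfl
    · cases b <;> rfl
    · rfl
  simp [Msg.decode, Msg.encode, Computability.decode_encodeNat, h]

/-- The components of a label. -/
structure Label where
  strat : Bool
  join : Bool
  stay : Bool
  ack : Bool
  sched : Bits

def Label.parse (l : Bits) : Label :=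
  ⟨l.getD 0 false, l.getD 1 false, l.getD 2 false, l.getD 3 false, l.drop 4⟩

/-- The coordinator is the node whose bits `join`, `stay`, `ack` are all `1`. -/
def Label.isCoordinator (l : Label) : Bool := l.join && l.stay && l.ack

/-- The node that starts the acknowledgement process by default has these bits equal to `001`. -/
def Label.isAcknowledger (l : Label) : Bool := !l.join && !l.stay && l.ack

def Label.numColours (l : Label) : ℕ := 2 ^ l.sched.length - 1

/-- The subroutines of the algorithm: a bounded acknowledged broadcast of "init", one of the two
variants of collecting the source messages at the coordinator, and a bounded acknowledged broadcast
of the collected source messages. -/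
inductive Stage where
  | initStage
  | individualCollect
  | roundRobinCollect
  | informStage
  | terminated
  deriving DecidableEq

/-- The local variables of a node. -/
structure NodeState where
  /-- the subroutine that is being executed -/
  stage : Stage
  /-- the number of the current phase of the individual collection -/
  phase : ℕ
  /-- the number of rounds elapsed since the coordinator started the current subroutine (or phase of
  the individual collection); meaningless at a node that has not yet received any message -/
  clock : ℕ
  /-- the value of `m` learned in the first subroutine -/
  bound : ℕ
  /-- the current broadcast message and the round in which the node received it first (at the
  coordinator: the round before it starts to transmit it) -/
  inf : Option (Content × ℕ)
  /-- the rounds in which the node transmitted the current broadcast message -/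
  sent : Finset ℕ
  /-- what the node heard in the preceding round -/
  heard : Option Msg
  /-- whether the coordinator received an "ack" message in the current phase -/
  acked : Bool
  /-- the source messages that the node possesses -/
  known : Finset Bits

namespace NodeState

def start (l : Label) (src : Option Bits) : NodeState where
  stage := .initStage
  phase := 0
  clock := 0
  bound := 0
  inf := if l.isCoordinator then some (.init, 0) else none
  sent := ∅
  heard := none
  acked := false
  known := src.toFinset

/-- Does a node informed of `c` in round `e` start the acknowledgement process in round `t`, and
with which attached information? In a bounded acknowledged broadcast (of "init" or of the collected
source messages) the default acknowledger does so in round `e + 1` and attaches `e`. In the `i`-th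
phase of the individual collection, the node with `sched` bits `i` does so in round `m + 1` and
attaches its source message. -/
def startsAck (l : Label) (src : Option Bits) (S : NodeState) (c : Content) (e t : ℕ) :
    Option AckBody :=
  match c with
  | .init => if l.isAcknowledger ∧ t = e + 1 then some (.round e) else none
  | .inform _ => if l.isAcknowledger ∧ t = e + 1 then some (.round e) else none
  | .done => if l.isAcknowledger ∧ t = e + 1 then some .plain else none
  | .query i =>
    if l.isCoordinator = false ∧ l.sched = Nat.bits i ∧ t = S.bound + 1 then
      src.map .sourceMsg else none
  | .bound _ => none

/-- The action of a node informed of `c` in round `e`, in round `t` of a broadcast. -/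
def broadcastAction (l : Label) (src : Option Bits) (S : NodeState) (c : Content) (e t : ℕ) :
    Option Msg :=
  if l.isCoordinator then
    if t = e + 1 then some (.data c t)
    else if S.heard = some .stay ∧ t - 2 ∈ S.sent then some (.data c t)
    else none
  else if l.stay ∧ t = e + 1 then some .stay
  else if l.join ∧ t = e + 2 then some (.data c t)
  else match S.heard with
    | some .stay => if t - 2 ∈ S.sent then some (.data c t) else none
    | some (.ack τ b) => if τ ∈ S.sent then some (.ack e b) else none
    | _ => (startsAck l src S c e t).map (.ack e)

/-- The action in the coming round (`none`: listen). -/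
def action (l : Label) (src : Option Bits) (S : NodeState) : Option Msg :=
  match S.stage with
  | .terminated => none
  | .roundRobinCollect =>
    if l.sched = binary l.sched.length (S.clock % l.numColours + 1) then some (.known S.known)
    else none
  | _ => S.inf.bind (fun p => broadcastAction l src S p.1 p.2 (S.clock + 1))

/-- Start the next subroutine (or phase); the coordinator broadcasts `c` in it. -/
def begin (l : Label) (S : NodeState) (stage : Stage) (phase : ℕ) (c : Content) : NodeState :=
  { S with
    stage := stage
    phase := phase
    clock := 0
    inf := if l.isCoordinator then some (c, 0) else none
    sent := ∅
    heard := none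
    acked := false }

/-- At the end of a round: check whether the current subroutine (or phase) is over. In the
individual collection, a phase in which the coordinator is itself the queried source counts as
acknowledged. -/
def advance (l : Label) (S : NodeState) : NodeState :=
  match S.stage with
  | .initStage =>
    match S.inf with
    | some (.bound m, _) =>
      if S.clock = 3 * m then
        if l.strat then
          { S.begin l .roundRobinCollect 0 .done with bound := m, inf := none }
        else { S.begin l .individualCollect 1 (.query 1) with bound := m }
      else S
    | _ => S
  | .individualCollect =>
    if S.clock = 2 * S.bound then
      match S.inf with
      | some (.done, _) => S.begin l .informStage 0 (.inform S.known)
      | _ =>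
        if S.acked = true ∨ l.sched = Nat.bits S.phase then
          S.begin l .individualCollect (S.phase + 1) (.query (S.phase + 1))
        else S.begin l .individualCollect (S.phase + 1) .done
    else S
  | .roundRobinCollect =>
    if S.clock = S.bound * l.numColours then S.begin l .informStage 0 (.inform S.known) else S
  | .informStage =>
    match S.inf with
    | some (.bound m, _) => if S.clock = 3 * m then { S with stage := .terminated } else S
    | _ => S
  | .terminated => S

/-- Bookkeeping for a round in which the node performed its action and heard `h`. On receiving a
broadcast message that is new to it, a node adopts the round number in the message as its clock
value. When the coordinator receives the acknowledgement of a bounded acknowledged broadcast, it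
starts to broadcast the attached value of `m`. -/
def receive (l : Label) (src : Option Bits) (S : NodeState) (h : Option Msg) : NodeState :=
  let t := S.clock + 1
  let S' : NodeState :=
    { S with
      clock := t
      heard := h
      sent := match S.action l src with
        | some (.data _ _) => insert t S.sent
        | _ => S.sent
      known := S.known ∪ (h.map Msg.contents).getD ∅ }
  match h with
  | some (.data c τ) =>
    if l.isCoordinator = false ∧ S.inf.map Prod.fst ≠ some c then
      { S' with inf := some (c, τ), sent := ∅, clock := τ }
    else S'
  | some (.ack τ b) =>
    if l.isCoordinator = true ∧ τ ∈ S.sent then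
      match b with
      | .round m => { S' with acked := true, inf := some (.bound m, t), sent := ∅ }
      | _ => { S' with acked := true }
    else S'
  | _ => S'

/-- The local variables after one more round, in which the node heard `b`. -/
def step (l : Label) (src : Option Bits) (S : NodeState) (b : Option Bits) : NodeState :=
  (S.receive l src (b.bind Msg.decode)).advance l

/-- The local variables of a node, as determined by its history. -/
def ofHistory (lab : Bits) (src : Option Bits) (H : List (Option Bits)) : NodeState :=
  H.foldl (step (Label.parse lab) src) (start (Label.parse lab) src)

end NodeState

/-- The algorithm for `k`-broadcast. -/
def KB : Algorithm where
  act lab src H :=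
    ((NodeState.ofHistory lab src H).action (Label.parse lab) src).map Msg.encode
  possesses lab src H := (NodeState.ofHistory lab src H).known

end RadioKB

namespace RadioKB

set_option linter.unusedSectionVars false

/-! Clocks. Before its first reception a node other than the coordinator is silent, and the first
broadcast message it receives tells it the coordinator's round number. Arbitrary starting rounds
therefore behave like a simultaneous start in the round in which the coordinator wakes up
(`similar_run`), and it suffices to follow the recursion `run` (`solves_of_run`).

Broadcast. Everything rests on the minimality of the transmitting sets: each transmitter has a
private neighbour in the frontier (`IsDomSequence.exists_private`), so every stage informs somebody
and the process reaches all nodes. A node that must transmit again is told so by a node that it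
alone informed, so "stay" messages do not collide at a transmitter; a newly informed node reads off
its `join` bit whether it transmits next. Hence exactly `dom i` transmits in stage `i`. `Schedule`
isolates the facts needed for this, and `Schedule.broadcast` alternates between `BeforeData` and
`AfterData`, two rounds per stage.

Acknowledgement. A node `u` other than `r` is informed by a unique neighbour `par u`, and among the
neighbours of `u` the attached round number singles out `par u` (`Schedule.mem_sent_iff`). An
acknowledgement thus travels alone along decreasing levels (`Schedule.ack_chain`). The last nodes
are informed in round `m = 2 M + 1`; all nodes learn `m` within `3 m` rounds and leave the first
subroutine together (`Schedule.run_initStage`). From then on a broadcast with its acknowledgement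
fits into `2 m` rounds, so the nodes stay aligned without further coordination.

Collection. If `k ≤ Δ`, query `i` is answered by the `i`-th source alone, and the unanswered query
`k + 1` ends the collection. If `k > Δ`, a distance-two colouring excludes collisions, so in each
phase every node learns what its neighbours knew; messages climb one parent per phase, and `m`
phases exceed the depth. One last broadcast spreads the collected set. Conversely, no node ever
possesses anything but source messages (`knownIn_run`), and possession is monotone, so nothing after
that broadcast needs to be followed.

Length. Besides four bits, a label holds either a number at most `k` (or a single bit), or a colour
among at most `Δ ^ 2 + Δ + 1`, both of which take `O(min {log k, log Δ})` bits in their respective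
cases, up to an additive constant. -/

open Classical in
/-- What `v` hears when the nodes transmit the (unencoded) messages `tx`. -/
noncomputable def hear {V : Type*} (G : SimpleGraph V) (tx : V → Option Msg) (v : V) : Option Msg :=
  if h : tx v = none ∧ ∃! w, G.Adj v w ∧ (tx w).isSome = true then tx h.2.choose else none

/-! ### Reception of unencoded messages -/

section Hear

variable {V : Type*} {G : SimpleGraph V} {tx : V → Option Msg} {v : V}

/-- Encoding does not change who transmits; uniqueness of the transmitter identifies the two nodes
picked by `choose`. -/
theorem hears_map_encode (G : SimpleGraph V) (tx : V → Option Msg) (v : V) :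
    hears G (fun w => (tx w).map Msg.encode) v = (hear G tx v).map Msg.encode := by
  unfold hears hear
  by_cases h : tx v = none ∧ ∃! w, G.Adj v w ∧ (tx w).isSome = true
  · have h' : (fun w => (tx w).map Msg.encode) v = none ∧
        ∃! w, G.Adj v w ∧ ((fun w => (tx w).map Msg.encode) w).isSome = true := by
      simpa using h
    rw [dif_pos h, dif_pos h']
    have hs := h'.2.choose_spec.1
    have := h.2.unique h.2.choose_spec.1 ⟨hs.1, (Option.isSome_map (f := Msg.encode)).symm.trans hs.2⟩
    exact congrArg (fun x => Option.map Msg.encode (tx x)) this.symm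
  · have h' : ¬ ((fun w => (tx w).map Msg.encode) v = none ∧
        ∃! w, G.Adj v w ∧ ((fun w => (tx w).map Msg.encode) w).isSome = true) := by
      simpa using h
    rw [dif_neg h, dif_neg h', Option.map_none]

theorem hear_eq_none (h : ∀ w, G.Adj v w → tx w = none) : hear G tx v = none := by
  unfold hear
  rw [dif_neg]
  rintro ⟨-, w, ⟨hw, hs⟩, -⟩
  simp [h w hw] at hs

theorem exists_of_hear_eq_some {m : Msg} (h : hear G tx v = some m) :
    tx v = none ∧ ∃ w, G.Adj v w ∧ tx w = some m ∧
      ∀ w', G.Adj v w' → (tx w').isSome = true → w' = w := by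
  unfold hear at h
  split_ifs at h with h'
  refine ⟨h'.1, h'.2.choose, h'.2.choose_spec.1.1, h, fun w' hw hs => ?_⟩
  exact h'.2.unique ⟨hw, hs⟩ h'.2.choose_spec.1

theorem hear_eq_some {m : Msg} {w : V} (hv : tx v = none) (hw : G.Adj v w) (hm : tx w = some m)
    (hu : ∀ w', G.Adj v w' → (tx w').isSome = true → w' = w) : hear G tx v = some m := by
  have h' : tx v = none ∧ ∃! w, G.Adj v w ∧ (tx w).isSome = true :=
    ⟨hv, w, ⟨hw, by simp [hm]⟩, fun y hy => hu y hy.1 hy.2⟩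
  unfold hear
  rw [dif_pos h', hu _ h'.2.choose_spec.1.1 h'.2.choose_spec.1.2, hm]

end Hear

namespace NodeState

variable (l : Label) (src : Option Bits) (S : NodeState) (h : Option Msg)

@[simp] theorem stage_receive : (S.receive l src h).stage = S.stage := by
  unfold receive; dsimp only; split <;> (try split_ifs) <;> (try split) <;> rfl

@[simp] theorem phase_receive : (S.receive l src h).phase = S.phase := by
  unfold receive; dsimp only; split <;> (try split_ifs) <;> (try split) <;> rfl

@[simp] theorem bound_receive : (S.receive l src h).bound = S.bound := by
  unfold receive; dsimp only; split <;> (try split_ifs) <;> (try split) <;> rfl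

@[simp] theorem heard_receive : (S.receive l src h).heard = h := by
  unfold receive; dsimp only; split <;> (try split_ifs) <;> (try split) <;> rfl

@[simp] theorem known_receive :
    (S.receive l src h).known = S.known ∪ (h.map Msg.contents).getD ∅ := by
  unfold receive; dsimp only; split <;> (try split_ifs) <;> (try split) <;> rfl

@[simp] theorem known_advance : (S.advance l).known = S.known := by
  unfold advance begin; split <;> (try split) <;> (try split_ifs) <;> (try split) <;> rfl

end NodeState

/-! ### Executions as iterations of a global round map -/

section Run

variable {V : Type*} (G : SimpleGraph V) (l : V → Label) (src : V → Option Bits)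

/-- The nodes' bookkeeping for one round, without the transition to the next subroutine. -/
noncomputable def rstep (S : V → NodeState) : V → NodeState := fun v =>
  (S v).receive (l v) (src v) (hear G (fun w => (S w).action (l w) (src w)) v)

/-- One complete round. -/
noncomputable def fstep (S : V → NodeState) : V → NodeState := fun v =>
  (rstep G l src S v).advance (l v)

/-- The execution in which all local clocks start simultaneously. -/
noncomputable def run (j : ℕ) : V → NodeState :=
  (fstep G l src)^[j] (fun v => NodeState.start (l v) (src v))

theorem run_zero : run G l src 0 = fun v => NodeState.start (l v) (src v) := rfl

theorem run_succ (j : ℕ) : run G l src (j + 1) = fstep G l src (run G l src j) :=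
  Function.iterate_succ_apply' _ _ _

/-- As long as no subroutine ends, complete rounds consist of the bookkeeping only. -/
theorem run_add_of_advance {T J : ℕ}
    (h : ∀ j, 0 < j → j < J → ∀ v, ((rstep G l src)^[j] (run G l src T) v).advance (l v) =
      (rstep G l src)^[j] (run G l src T) v) :
    ∀ j < J, run G l src (T + j) = (rstep G l src)^[j] (run G l src T) := by
  intro j
  induction j with
  | zero => intro _; rfl
  | succ j ih =>
    intro hj
    rw [← add_assoc, run_succ, ih (by omega), Function.iterate_succ_apply']
    funext v
    have := h (j + 1) (by omega) hj v
    rw [Function.iterate_succ_apply'] at this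
    exact this

/-- Covers the round `J` itself, in which the subroutine may end: `advance` takes effect only once,
after `J` rounds of bookkeeping. -/
theorem run_add_of_advance_end {T J : ℕ} (hJ : 0 < J)
    (h : ∀ j, 0 < j → j < J → ∀ v, ((rstep G l src)^[j] (run G l src T) v).advance (l v) =
      (rstep G l src)^[j] (run G l src T) v) (v : V) :
    run G l src (T + J) v = ((rstep G l src)^[J] (run G l src T) v).advance (l v) := by
  obtain ⟨J, rfl⟩ : ∃ J', J = J' + 1 := ⟨J - 1, by omega⟩
  rw [← add_assoc, run_succ, run_add_of_advance G l src h J (by omega),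
    Function.iterate_succ_apply']
  rfl

end Run

/-! ### Reduction to simultaneously started clocks -/

/-- `S` and `S'` agree, except that clocks and last receptions may differ as long as the node has
not been informed for the first time. -/
def Similar (l : Label) (S S' : NodeState) : Prop :=
  S = S' ∨ (l.isCoordinator = false ∧ S.stage = .initStage ∧ S.inf = none ∧
    ∃ c h, S' = { S with clock := c, heard := h })

namespace Similar

variable {l : Label} {src : Option Bits} {S S' : NodeState}

theorem known (h : Similar l S S') : S.known = S'.known := by
  rcases h with rfl | ⟨-, -, -, c, h, rfl⟩ <;> rfl

theorem action_eq (h : Similar l S S') : S.action l src = S'.action l src := by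
  rcases h with rfl | ⟨-, hs, hi, c, h, rfl⟩
  · rfl
  · simp [NodeState.action, hs, hi]

theorem action_eq_none (hs : S.stage = .initStage) (hi : S.inf = none) :
    S.action l src = none := by
  simp [NodeState.action, hs, hi]

/-- A broadcast message makes the two states equal, since its stamp overwrites the clock and the
reception overwrites `heard`. After any other reception the node is still uninformed. -/
theorem receive_advance (h : Similar l S S') (m : Option Msg) :
    Similar l ((S.receive l src m).advance l) ((S'.receive l src m).advance l) := by
  rcases h with rfl | ⟨hc, hs, hi, c, h, rfl⟩
  · exact .inl rfl
  · have ha : S.action l src = none := by simp [NodeState.action, hs, hi]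
    rcases m with _ | ⟨d, τ⟩ | _ | ⟨τ, b⟩ | K
    · right
      simp [NodeState.receive, NodeState.advance, ha, action_eq_none, hs, hi, hc]
    · left
      simp [NodeState.receive, hs, hi, hc]
    · right
      simp [NodeState.receive, NodeState.advance, ha, action_eq_none, hs, hi, hc]
    · right
      simp [NodeState.receive, NodeState.advance, ha, action_eq_none, hs, hi, hc]
    · right
      simp [NodeState.receive, NodeState.advance, ha, action_eq_none, hs, hi, hc]

theorem advance_receive_none (hs : S.stage = .initStage) (hi : S.inf = none)
    (hc : l.isCoordinator = false) : Similar l S ((S.receive l src none).advance l) := by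
  right
  have ha : S.action l src = none := by simp [NodeState.action, hs, hi]
  simp [NodeState.receive, NodeState.advance, ha, hs, hi, hc]

theorem symm (h : Similar l S S') : Similar l S' S := by
  rcases h with rfl | ⟨hc, hs, hi, c, h, rfl⟩
  · exact .inl rfl
  · exact .inr ⟨hc, hs, hi, S.clock, S.heard, rfl⟩

theorem trans {S'' : NodeState} (h : Similar l S S') (h' : Similar l S' S'') : Similar l S S'' := by
  rcases h with rfl | ⟨hc, hs, hi, c, h, rfl⟩
  · exact h'
  · rcases h' with rfl | ⟨_, _, _, c', h', rfl⟩
    · exact .inr ⟨hc, hs, hi, c, h, rfl⟩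
    · exact .inr ⟨hc, hs, hi, c', h', rfl⟩

end Similar

section Wake

variable {V : Type*} (G : SimpleGraph V) (lab : V → Bits) (src : V → Option Bits) (wake : V → ℕ)

/-- The local variables of `v` before round `t` (initial values if its clock has not started). -/
noncomputable def stateAt (t : ℕ) (v : V) : NodeState :=
  NodeState.ofHistory (lab v) (src v) ((history G KB lab src wake t v).getD [])

theorem ofHistory_append (lab : Bits) (src : Option Bits) (H : List (Option Bits))
    (b : Option Bits) : NodeState.ofHistory lab src (H ++ [b]) =
      (NodeState.ofHistory lab src H).step (Label.parse lab) src b := by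
  simp [NodeState.ofHistory]

theorem bind_decode_map_encode (x : Option Msg) : (x.map Msg.encode).bind Msg.decode = x := by
  cases x <;> simp [Msg.decode_encode]

/-- The message that `v` hears in round `t`. -/
noncomputable def heardIn (t : ℕ) (v : V) : Option Msg :=
  hear G (fun w => (history G KB lab src wake t w).bind
    (fun _ => (stateAt G lab src wake t w).action (Label.parse (lab w)) (src w))) v

theorem hears_history (t : ℕ) (v : V) :
    hears G (fun w => (history G KB lab src wake t w).bind (KB.act (lab w) (src w))) v =
      (heardIn G lab src wake t v).map Msg.encode := by
  rw [heardIn, ← hears_map_encode]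
  congr 1
  funext w
  cases h : history G KB lab src wake t w <;> simp only [stateAt, h] <;> simp [KB]

theorem history_ne_none {t : ℕ} {v : V} (h : wake v ≤ t) :
    ∃ H, history G KB lab src wake t v = some H := by
  induction t with
  | zero => exact ⟨[], by simp [history, Nat.le_zero.mp h]⟩
  | succ t ih =>
    rw [history]
    split
    · exact ⟨_, rfl⟩
    · exact ⟨_, rfl⟩
    · exact ⟨_, by rw [if_pos h]⟩

/-- A sleeping node that hears a message starts its history with it, which is an ordinary round from
the initial state. Only a sleeping node that hears nothing is exceptional. -/
theorem stateAt_succ (t : ℕ) (v : V) :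
    stateAt G lab src wake (t + 1) v = ((stateAt G lab src wake t v).receive (Label.parse (lab v))
      (src v) (heardIn G lab src wake t v)).advance (Label.parse (lab v)) ∨
    (history G KB lab src wake t v = none ∧ heardIn G lab src wake t v = none ∧
      stateAt G lab src wake (t + 1) v = NodeState.start (Label.parse (lab v)) (src v) ∧
      stateAt G lab src wake t v = NodeState.start (Label.parse (lab v)) (src v)) := by
  have key := hears_history G lab src wake t v
  have hd := bind_decode_map_encode (heardIn G lab src wake t v)
  cases h : history G KB lab src wake t v with
  | some H =>
    left
    rw [stateAt, history]
    simp only [key, h, stateAt, Option.getD_some, ofHistory_append, NodeState.step, hd]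
  | none =>
    cases h' : heardIn G lab src wake t v with
    | some m =>
      left
      have : history G KB lab src wake (t + 1) v = some [some m.encode] := by
        rw [history]
        simp only [key, h, h', Option.map_some]
      rw [h'] at hd
      simp only [stateAt, h, this, Option.getD_some, Option.getD_none]
      simp only [NodeState.ofHistory, List.foldl, NodeState.step]
      simp [Msg.decode_encode]
    | none =>
      right
      refine ⟨rfl, rfl, ?_, by simp [stateAt, h, NodeState.ofHistory]⟩
      have : (history G KB lab src wake (t + 1) v).getD [] = [] := by
        rw [history]
        simp only [key, h, h', Option.map_none]
        split_ifs <;> rfl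
      simp [stateAt, this, NodeState.ofHistory]

variable {r : V} (hr : ∀ v, (Label.parse (lab v)).isCoordinator = true ↔ v = r)
include hr

theorem action_start_eq_none {v : V} (hv : v ≠ r) :
    (NodeState.start (Label.parse (lab v)) (src v)).action (Label.parse (lab v)) (src v) = none := by
  have : (Label.parse (lab v)).isCoordinator = false := by
    rw [← Bool.not_eq_true, hr]; exact hv
  simp [NodeState.action, NodeState.start, this]

/-- Nobody transmits before the coordinator wakes up: the coordinator has no history yet, and all
other nodes, awake or not, are uninformed. -/
theorem stateAt_before (t : ℕ) (ht : t ≤ wake r) :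
    (t < wake r → history G KB lab src wake t r = none) ∧
    stateAt G lab src wake t r = NodeState.start (Label.parse (lab r)) (src r) ∧
    ∀ v, v ≠ r → Similar (Label.parse (lab v)) (stateAt G lab src wake t v)
      (NodeState.start (Label.parse (lab v)) (src v)) := by
  induction t with
  | zero =>
    have : ∀ v, stateAt G lab src wake 0 v = NodeState.start (Label.parse (lab v)) (src v) := by
      intro v
      simp only [stateAt, history]
      split_ifs <;> simp [NodeState.ofHistory]
    refine ⟨fun h => ?_, this r, fun v _ => .inl (this v)⟩
    simp [history]; omega
  | succ t ih =>
    obtain ⟨h1, h2, h3⟩ := ih (by omega)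
    have hN : ∀ v, heardIn G lab src wake t v = none := by
      intro v
      refine hear_eq_none fun w _ => ?_
      by_cases hw : w = r
      · simp [hw, h1 (by omega)]
      · rw [(h3 w hw).action_eq, action_start_eq_none lab src hr hw]
        simp
    have hst : ∀ v, v ≠ r → Similar (Label.parse (lab v)) (stateAt G lab src wake (t + 1) v)
        (NodeState.start (Label.parse (lab v)) (src v)) := by
      intro v hv
      have hc : (Label.parse (lab v)).isCoordinator = false := by
        rw [← Bool.not_eq_true, hr]; exact hv
      rcases stateAt_succ G lab src wake t v with h | ⟨-, -, h, -⟩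
      · rw [h, hN]
        refine ((h3 v hv).receive_advance none).trans (Similar.symm ?_)
        exact Similar.advance_receive_none rfl (by simp [NodeState.start, hc]) hc
      · exact .inl h
    have hr1 : history G KB lab src wake (t + 1) r = if wake r ≤ t + 1 then some [] else none := by
      rw [history]
      simp only [hears_history, h1 (by omega), hN r, Option.map_none]
    refine ⟨fun h => ?_, ?_, hst⟩
    · rw [hr1, if_neg (by omega)]
    · simp only [stateAt, hr1]
      split_ifs <;> simp [NodeState.ofHistory]

/-- The nodes behave as if all local clocks started when the clock of the coordinator does. -/
theorem similar_run (j : ℕ) (v : V) :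
    Similar (Label.parse (lab v)) (stateAt G lab src wake (wake r + j) v)
      (run G (fun v => Label.parse (lab v)) src j v) := by
  induction j generalizing v with
  | zero =>
    obtain ⟨-, h2, h3⟩ := stateAt_before G lab src wake hr (wake r) le_rfl
    by_cases hv : v = r
    · subst hv; exact .inl h2
    · exact h3 v hv
  | succ j ih =>
    have hh : heardIn G lab src wake (wake r + j) v = hear G (fun w =>
        (run G (fun v => Label.parse (lab v)) src j w).action (Label.parse (lab w)) (src w)) v := by
      rw [heardIn]
      congr 1
      funext w
      rw [← (ih w).action_eq]
      cases h : history G KB lab src wake (wake r + j) w with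
      | some H => simp
      | none =>
        -- The coordinator is awake from round `wake r` on. Any node still asleep is silent, and so
        -- is its simulated counterpart in the initial state.
        have hw : w ≠ r := by
          rintro rfl
          obtain ⟨H, hH⟩ := history_ne_none G lab src wake (Nat.le_add_right (wake w) j)
          simp [hH] at h
        simp only [stateAt, h, Option.bind_none, Option.getD_none]
        exact (action_start_eq_none lab src hr hw).symm
    rw [run_succ]
    change Similar _ _ ((NodeState.receive _ _ _ _).advance _)
    rw [← hh]
    rcases stateAt_succ G lab src wake (wake r + j) v with h | ⟨h0, h1, h2, h3⟩
    · rw [← add_assoc, h]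
      exact (ih v).receive_advance _
    · have hw : v ≠ r := by
        rintro rfl
        obtain ⟨H, hH⟩ := history_ne_none G lab src wake (Nat.le_add_right (wake v) j)
        simp [hH] at h0
      have hc : (Label.parse (lab v)).isCoordinator = false := by
        rw [← Bool.not_eq_true, hr]; exact hw
      rw [← add_assoc, h2, h1]
      refine Similar.trans ?_ ((h3 ▸ ih v).receive_advance none)
      exact Similar.advance_receive_none rfl (by simp [NodeState.start, hc]) hc

theorem solves_of_run [Fintype V] [DecidableEq V] {k : ℕ} {s : Fin k ↪ V} {μ : Fin k → Bits}
    (hsrc : src = sourceMessage s μ)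
    (h : ∃ J, ∀ j ≥ J, ∀ v, (run G (fun v => Label.parse (lab v)) src j v).known =
      Finset.univ.image μ) :
    Solves KB lab s μ wake (G := G) := by
  subst hsrc
  obtain ⟨J, hJ⟩ := h
  -- `Solves` also requires every local clock to have started, hence the supremum of the starting
  -- rounds.
  refine ⟨max (wake r + J) (Finset.univ.sup wake), fun t ht v => ?_⟩
  obtain ⟨H, hH⟩ := history_ne_none G lab (sourceMessage s μ) wake (t := t) (v := v)
    ((Finset.le_sup (f := wake) (Finset.mem_univ v)).trans ((le_max_right _ _).trans ht))
  refine ⟨H, hH, ?_⟩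
  have h1 := similar_run G lab (sourceMessage s μ) wake hr (t - wake r) v
  have h2 := le_max_left (wake r + J) (Finset.univ.sup wake)
  rw [show wake r + (t - wake r) = t by omega] at h1
  have h3 := h1.known
  rw [hJ _ (by omega)] at h3
  rw [← h3]
  simp only [stateAt, hH]
  rfl

end Wake

/-! ### Combinatorics of the minimal dominating sets -/

section DomSequence

variable {V : Type*} [Fintype V] [DecidableEq V] {G : SimpleGraph V} [DecidableRel G.Adj]
  {r : V} {dom : ℕ → Finset V}

theorem mem_frontier {I : Finset V} {v : V} :
    v ∈ frontier G I ↔ v ∉ I ∧ ∃ u ∈ I, G.Adj u v := by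
  simp [frontier]

theorem mem_newly {I D : Finset V} {v : V} :
    v ∈ newly G I D ↔ v ∈ frontier G I ∧ ∃! u, u ∈ D ∧ G.Adj u v := by
  simp [newly, Finset.card_eq_one, Finset.eq_singleton_iff_unique_mem, ExistsUnique]

theorem mem_informed_succ {i : ℕ} {v : V} :
    v ∈ informed G r dom (i + 1) ↔ v ∈ informed G r dom i ∨ v ∈ newAt G r dom i := by
  simp [informed, newAt]

theorem informed_mono : Monotone (informed G r dom) :=
  monotone_nat_of_le_succ fun _ _ hv => mem_informed_succ.mpr (.inl hv)

theorem not_mem_informed_of_newAt {i : ℕ} {v : V} (h : v ∈ newAt G r dom i) :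
    v ∉ informed G r dom i :=
  (mem_frontier.mp (mem_newly.mp h).1).1

theorem frontier_nonempty (hG : G.Connected) {I : Finset V} (hr : r ∈ I) (hI : I ≠ Finset.univ) :
    (frontier G I).Nonempty := by
  obtain ⟨w, hw⟩ : ∃ w, w ∉ I := by
    by_contra! h
    exact hI (Finset.eq_univ_of_forall h)
  obtain ⟨p⟩ := hG.preconnected r w
  obtain ⟨d, -, hd1, hd2⟩ := p.exists_boundary_dart (I : Set V) (by simpa) (by simpa)
  exact ⟨d.snd, mem_frontier.mpr ⟨by simpa using hd2, d.fst, by simpa using hd1, d.adj⟩⟩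

namespace IsDomSequence

variable (h : IsDomSequence G r dom)
include h

theorem subset_informed (i : ℕ) : dom i ⊆ informed G r dom i := by
  induction i with
  | zero => simp [h.zero, informed]
  | succ i ih =>
    intro v hv
    have := (h.succ i).prop.1 hv
    rw [Finset.mem_union] at this
    exact mem_informed_succ.mpr (this.imp (@ih v) id)

theorem exists_adj_of_mem_frontier {i : ℕ} {v : V}
    (hv : v ∈ frontier G (informed G r dom i)) : ∃ u ∈ dom i, G.Adj u v := by
  cases i with
  | zero =>
    obtain ⟨-, u, hu, ha⟩ := mem_frontier.mp hv
    exact ⟨u, by simpa [h.zero, informed] using hu, ha⟩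
  | succ i => exact (h.succ i).prop.2 v hv

/-- By minimality, each transmitting node has a private neighbour. -/
theorem exists_private {i : ℕ} {u : V} (hu : u ∈ dom (i + 1)) :
    ∃ v ∈ frontier G (informed G r dom (i + 1)), G.Adj u v ∧
      ∀ u' ∈ dom (i + 1), G.Adj u' v → u' = u := by
  by_contra! hcon
  have hD := (h.succ i).prop
  -- If each frontier neighbour of `u` had another neighbour in the set, `u` could be erased.
  have hle := (h.succ i).le_of_le (y := (dom (i + 1)).erase u)
    ⟨(Finset.erase_subset _ _).trans hD.1, fun v hv => ?_⟩ (Finset.erase_subset _ _)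
  · exact Finset.notMem_erase u _ (hle hu)
  · obtain ⟨w, hw, hwv⟩ := hD.2 v hv
    by_cases hwu : w = u
    · subst hwu
      obtain ⟨u', hu', ha', hne⟩ := hcon v hv hwv
      exact ⟨u', Finset.mem_erase.mpr ⟨hne, hu'⟩, ha'⟩
    · exact ⟨w, Finset.mem_erase.mpr ⟨hwu, hw⟩, hwv⟩

/-- A node that transmits in two consecutive stages has a neighbour that is first informed in the
former one. -/
theorem exists_adj_newAt {i : ℕ} {v : V} (hv : v ∈ dom i) (hv' : v ∈ dom (i + 1)) :
    ∃ w ∈ newAt G r dom i, G.Adj v w := by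
  cases i with
  -- Minimality is imposed only from stage 1 on. In stage 0 the node is `r`, the sole transmitter,
  -- and any neighbour of it is new.
  | zero =>
    obtain ⟨w, hw, ha, -⟩ := h.exists_private hv'
    have hvr : v = r := by simpa [h.zero] using hv
    subst hvr
    have h1 := (mem_frontier.mp hw).1
    have h0 : w ∉ informed G v dom 0 := fun h' => h1 (informed_mono (Nat.zero_le _) h')
    refine ⟨w, mem_newly.mpr ⟨mem_frontier.mpr ⟨h0, v, by simp [informed], ha⟩, v, ?_, ?_⟩, ha⟩
    · simp [h.zero, ha]
    · simp [h.zero]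
  | succ i =>
    obtain ⟨w, hw, ha, hu⟩ := h.exists_private hv
    exact ⟨w, mem_newly.mpr ⟨hw, v, ⟨hv, ha⟩, fun u' hu' => hu u' hu'.1 hu'.2⟩, ha⟩

/-- Connectedness gives a frontier node and hence a transmitter; a private neighbour of that
transmitter suffers no collision. -/
theorem newAt_nonempty (hG : G.Connected) {i : ℕ} (hi : informed G r dom i ≠ Finset.univ) :
    (newAt G r dom i).Nonempty := by
  obtain ⟨v, hv⟩ := frontier_nonempty hG (r := r)
    (informed_mono (Nat.zero_le i) (by simp [informed])) hi
  obtain ⟨u, hu, ha⟩ := h.exists_adj_of_mem_frontier hv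
  cases i with
  | zero =>
    refine ⟨v, mem_newly.mpr ⟨hv, u, ⟨hu, ha⟩, fun u' hu' => ?_⟩⟩
    simp only [h.zero, Finset.mem_singleton] at hu hu'
    rw [hu, hu'.1]
  | succ i =>
    obtain ⟨w, hw, ha, hu'⟩ := h.exists_private hu
    exact ⟨w, mem_newly.mpr ⟨hw, u, ⟨hu, ha⟩, fun u' h' => hu' u' h'.1 h'.2⟩⟩

theorem exists_informed_eq_univ (hG : G.Connected) :
    ∃ i, informed G r dom i = Finset.univ := by
  by_contra! hcon
  have : ∀ i, i ≤ (informed G r dom i).card := by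
    intro i
    induction i with
    | zero => exact Nat.zero_le _
    | succ i ih =>
      obtain ⟨w, hw⟩ := h.newAt_nonempty hG (hcon i)
      refine ih.trans_lt (Finset.card_lt_card ?_)
      exact (Finset.ssubset_iff_of_subset (informed_mono i.le_succ)).mpr
        ⟨w, mem_informed_succ.mpr (.inr hw), not_mem_informed_of_newAt hw⟩
  have h1 := this (Fintype.card V + 1)
  have h2 := Finset.card_le_univ (informed G r dom (Fintype.card V + 1))
  omega

theorem dom_eq_empty {i : ℕ} (hi : informed G r dom (i + 1) = Finset.univ) :
    dom (i + 1) = ∅ := by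
  by_contra hne
  obtain ⟨u, hu⟩ := Finset.nonempty_iff_ne_empty.mpr hne
  obtain ⟨v, hv, -⟩ := h.exists_private hu
  exact (mem_frontier.mp hv).1 (hi ▸ Finset.mem_univ v)

end IsDomSequence

/-! ### Existence -/

open Classical in
/-- Informed and transmitting nodes, with some choice of the minimal dominating sets. -/
noncomputable def stagePair (G : SimpleGraph V) [DecidableRel G.Adj] (r : V) :
    ℕ → Finset V × Finset V
  | 0 => ({r}, {r})
  | i + 1 =>
    let I := (stagePair G r i).1
    let D := (stagePair G r i).2
    let I' := I ∪ newly G I D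
    (I', if h : ∃ D', Minimal (fun D' : Finset V => D' ⊆ D ∪ newly G I D ∧
      ∀ v ∈ frontier G I', ∃ u ∈ D', G.Adj u v) D' then h.choose else ∅)

theorem informed_stagePair (r : V) (i : ℕ) :
    informed G r (fun j => (stagePair G r j).2) i = (stagePair G r i).1 := by
  induction i with
  | zero => rfl
  | succ i ih => rw [informed, ih, stagePair]

/-- Domination of the current frontier is the invariant that keeps the choice possible. A node of
the next frontier has an informed neighbour: if this one is new, it may be used itself; otherwise
the node was in the frontier before and is dominated by the previous set. Finiteness then yields a
minimal set. -/
theorem exists_minimal_dominating (r : V) (i : ℕ) :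
    (∀ v ∈ frontier G (stagePair G r i).1, ∃ u ∈ (stagePair G r i).2, G.Adj u v) ∧
    Minimal (fun D' : Finset V =>
      D' ⊆ (stagePair G r i).2 ∪ newly G (stagePair G r i).1 (stagePair G r i).2 ∧
      ∀ v ∈ frontier G (stagePair G r (i + 1)).1, ∃ u ∈ D', G.Adj u v)
      (stagePair G r (i + 1)).2 := by
  have key : ∀ i, (∀ v ∈ frontier G (stagePair G r i).1, ∃ u ∈ (stagePair G r i).2, G.Adj u v) →
      Minimal (fun D' : Finset V =>
      D' ⊆ (stagePair G r i).2 ∪ newly G (stagePair G r i).1 (stagePair G r i).2 ∧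
      ∀ v ∈ frontier G (stagePair G r (i + 1)).1, ∃ u ∈ D', G.Adj u v)
      (stagePair G r (i + 1)).2 := by
    intro i hi
    have hex : ∃ D', Minimal (fun D' : Finset V =>
        D' ⊆ (stagePair G r i).2 ∪ newly G (stagePair G r i).1 (stagePair G r i).2 ∧
        ∀ v ∈ frontier G (stagePair G r (i + 1)).1, ∃ u ∈ D', G.Adj u v) D' := by
      have := exists_minimal_le_of_wellFoundedLT (fun D' : Finset V =>
        D' ⊆ (stagePair G r i).2 ∪ newly G (stagePair G r i).1 (stagePair G r i).2 ∧
        ∀ v ∈ frontier G (stagePair G r (i + 1)).1, ∃ u ∈ D', G.Adj u v)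
        ((stagePair G r i).2 ∪ newly G (stagePair G r i).1 (stagePair G r i).2)
        ⟨subset_rfl, fun v hv => ?_⟩
      · exact this.imp fun _ h => h.2
      · obtain ⟨hv', u, hu, ha⟩ := mem_frontier.mp hv
        simp only [stagePair, Finset.mem_union, not_or] at hv' hu
        rcases hu with hu | hu
        · obtain ⟨w, hw, hwa⟩ := hi v (mem_frontier.mpr ⟨hv'.1, u, hu, ha⟩)
          exact ⟨w, Finset.mem_union_left _ hw, hwa⟩
        · exact ⟨u, Finset.mem_union_right _ hu, ha⟩
    have heq : (stagePair G r (i + 1)).2 = hex.choose := dif_pos hex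
    rw [heq]
    exact hex.choose_spec
  suffices hs : ∀ v ∈ frontier G (stagePair G r i).1, ∃ u ∈ (stagePair G r i).2, G.Adj u v from
    ⟨hs, key i hs⟩
  induction i with
  | zero =>
    intro v hv
    exact (mem_frontier.mp hv).2
  | succ i ih => exact (key i ih).prop.2

theorem exists_isDomSequence (G : SimpleGraph V) [DecidableRel G.Adj] (r : V) :
    ∃ dom, IsDomSequence G r dom := by
  refine ⟨fun j => (stagePair G r j).2, rfl, fun i => ?_⟩
  rw [newAt, informed_stagePair, informed_stagePair]
  exact (exists_minimal_dominating r i).2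

theorem exists_isAckLabeling (hG : G.Connected) (r : V) :
    ∃ join stay ack, IsAckLabeling G r join stay ack := by
  classical
  obtain ⟨dom, h⟩ := exists_isDomSequence G r
  have hst : ∀ i v, ∃ w, v ∈ dom i ∩ dom (i + 1) → w ∈ newAt G r dom i ∧ G.Adj v w := by
    intro i v
    by_cases hv : v ∈ dom i ∩ dom (i + 1)
    · obtain ⟨w, hw⟩ := h.exists_adj_newAt (Finset.mem_inter.mp hv).1 (Finset.mem_inter.mp hv).2
      exact ⟨w, fun _ => hw⟩
    · exact ⟨v, fun h' => absurd h' hv⟩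
  choose stayer hst using hst
  obtain ⟨z, hz⟩ : ∃ z, ∀ i, z ∈ informed G r dom i → informed G r dom i = Finset.univ := by
    have hex := h.exists_informed_eq_univ hG
    have hspec := Nat.find_spec hex
    rcases hn : Nat.find hex with _ | n
    · rw [hn] at hspec
      exact ⟨r, fun i _ => Finset.univ_subset_iff.mp
        (hspec ▸ informed_mono (G := G) (r := r) (dom := dom) (Nat.zero_le i))⟩
    -- Any node missing from the last incomplete informed set is informed last.
    · have := Nat.find_min hex (m := n) (by omega)
      obtain ⟨z, hz⟩ : ∃ z, z ∉ informed G r dom n := by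
        by_contra! h'
        exact this (Finset.eq_univ_of_forall h')
      refine ⟨z, fun i hi => ?_⟩
      have hlt : n + 1 ≤ i := by
        by_contra hlt
        exact hz (informed_mono (by omega) hi)
      rw [hn] at hspec
      exact Finset.univ_subset_iff.mp
        (hspec ▸ informed_mono (G := G) (r := r) (dom := dom) hlt)
  exact ⟨fun v => decide (∃ i, v ∈ dom i),
    fun w => decide (∃ i, ∃ v ∈ dom i ∩ dom (i + 1), stayer i v = w), fun v => decide (v = z),
    dom, stayer, z, h, by simp, fun i v hv => hst i v hv, by simp, hz, by simp⟩

end DomSequence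

/-! ### The schedule of a broadcast -/

/-- The facts about the labeling scheme on which the correctness of a broadcast from `r` rests.
Nodes in `dom i` transmit in stage `i`, for `i ≤ M`; `lvl r = 0`, and a node first informed in stage
`i` has `lvl v = i + 1` and is informed by `par v`. -/
structure Schedule {V : Type*} (G : SimpleGraph V) (r : V) (l : V → Label)
    (lvl : V → ℕ) (dom : ℕ → Finset V) (par : V → V) (M : ℕ) (z : V) : Prop where
  coord : ∀ v, (l v).isCoordinator = true ↔ v = r
  lvl_eq_zero : ∀ v, lvl v = 0 ↔ v = r
  lvl_le : ∀ v, lvl v ≤ M + 1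
  lvl_le_of_dom : ∀ i, ∀ v ∈ dom i, lvl v ≤ i
  dom_zero : ∀ v, v ∈ dom 0 ↔ v = r
  dom_succ : ∀ i, ∀ v ∈ dom (i + 1), v ∈ dom i ∨ lvl v = i + 1
  par_mem : ∀ i v, lvl v = i + 1 → par v ∈ dom i
  adj_par : ∀ v, v ≠ r → G.Adj v (par v)
  eq_par : ∀ i v u, lvl v = i + 1 → u ∈ dom i → G.Adj v u → u = par v
  not_unique : ∀ i v, i + 1 < lvl v → ¬ ∃ u ∈ dom i, G.Adj v u ∧ ∀ u' ∈ dom i, G.Adj v u' → u' = u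
  join_iff : ∀ i v, lvl v = i + 1 → ((l v).join = true ↔ v ∈ dom (i + 1))
  dom_last : dom (M + 1) = ∅
  stay_last : ∀ w, lvl w = M + 1 → (l w).stay = false
  stay_exists : ∀ i, ∀ v ∈ dom i, v ∈ dom (i + 1) →
    ∃ w, lvl w = i + 1 ∧ G.Adj v w ∧ (l w).stay = true
  stay_dom : ∀ i, ∀ v ∈ dom i, ∀ w, lvl w = i + 1 → G.Adj v w → (l w).stay = true → v ∈ dom (i + 1)
  stay_unique : ∀ i, ∀ v ∈ dom i, ∀ w, lvl w = i + 1 → G.Adj v w → (l w).stay = true →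
    ∀ w', lvl w' = i + 1 → G.Adj v w' → (l w').stay = true → w' = w
  lvl_acknowledger : lvl z = M + 1
  acknowledger : ∀ v, (l v).isAcknowledger = true ↔ v = z

section

variable {V : Type*} [Fintype V] [DecidableEq V] {G : SimpleGraph V} [DecidableRel G.Adj]
  {r : V} {l : V → Label} {join stay ack : V → Bool}

theorem exists_schedule [Nontrivial V] (hG : G.Connected) (h : IsAckLabeling G r join stay ack)
    (hr : (l r).join = true ∧ (l r).stay = true ∧ (l r).ack = true)
    (hl : ∀ v, v ≠ r → (l v).join = join v ∧ (l v).stay = stay v ∧ (l v).ack = ack v) :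
    ∃ lvl dom par M z, Schedule G r l lvl dom par M z := by
  classical
  obtain ⟨dom, stayer, z, hd, hjoin, hst, hstay, hz, hack⟩ := h
  have hex := hd.exists_informed_eq_univ hG
  have hspec := Nat.find_spec hex
  have hmin := fun m => @Nat.find_min _ _ hex m
  -- A second node exists, so `{r}` is not everything; `M` is the last stage that informs anybody.
  obtain ⟨M, hM⟩ : ∃ M, Nat.find hex = M + 1 := by
    refine Nat.exists_eq_succ_of_ne_zero fun h0 => ?_
    rw [h0] at hspec
    obtain ⟨v, hv⟩ := exists_ne r
    have := hspec ▸ Finset.mem_univ v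
    simp [informed] at this
    exact hv this
  rw [hM] at hspec hmin
  have hMne := hmin M M.lt_succ_self
  clear hmin hM
  have hin : ∀ v, ∃ i, v ∈ informed G r dom i := fun v => ⟨M + 1, hspec ▸ Finset.mem_univ v⟩
  set lvl : V → ℕ := fun v => Nat.find (hin v) with hlvl
  have lvl_le_iff : ∀ v i, lvl v ≤ i ↔ v ∈ informed G r dom i := fun v i =>
    ⟨fun h => informed_mono h (Nat.find_spec (hin v)), fun h => Nat.find_min' _ h⟩
  have lvl_eq_iff : ∀ v i, lvl v = i + 1 ↔ v ∈ newAt G r dom i := by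
    intro v i
    have h1 := lvl_le_iff v i
    have h2 := lvl_le_iff v (i + 1)
    rw [mem_informed_succ] at h2
    constructor
    · intro h
      rcases h2.mp h.le with h3 | h3
      · have := h1.mpr h3; omega
      · exact h3
    · intro h
      have h3 := h2.mpr (.inr h)
      have h4 : ¬ lvl v ≤ i := fun h' => not_mem_informed_of_newAt h (h1.mp h')
      omega
  have lvl_zero : ∀ v, lvl v = 0 ↔ v = r := by
    intro v
    rw [← Nat.le_zero, lvl_le_iff]
    simp [informed]
  have hne : ∀ v i, lvl v = i + 1 → v ≠ r := by
    intro v i h hv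
    rw [← lvl_zero, h] at hv
    omega
  have hpar : ∀ v, ∃ u, v ≠ r → (u ∈ dom (lvl v - 1) ∧ G.Adj u v) ∧
      ∀ u', u' ∈ dom (lvl v - 1) ∧ G.Adj u' v → u' = u := by
    intro v
    by_cases hv : v = r
    · exact ⟨v, fun h => absurd hv h⟩
    · have h0 : lvl v ≠ 0 := fun h => hv ((lvl_zero v).mp h)
      obtain ⟨u, hu⟩ := (mem_newly.mp ((lvl_eq_iff v (lvl v - 1)).mp (by omega))).2
      exact ⟨u, fun _ => hu⟩
  choose par hpar using hpar
  have hdl : ∀ i, ∀ v ∈ dom i, lvl v ≤ i := fun i v hv =>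
    (lvl_le_iff v i).mpr (hd.subset_informed i hv)
  have hds : ∀ i, ∀ v ∈ dom (i + 1), v ∈ dom i ∨ lvl v = i + 1 := by
    intro i v hv
    have := (hd.succ i).prop.1 hv
    rw [Finset.mem_union] at this
    rwa [lvl_eq_iff]
  -- A node can enter the transmitting sets only directly after being informed, because each set
  -- consists of previous transmitters and new nodes. This is why the single bit `join` suffices.
  have hjl : ∀ i v, lvl v = i + 1 → ((∃ j, v ∈ dom j) ↔ v ∈ dom (i + 1)) := by
    refine fun i v hv => ⟨fun ⟨j, hj⟩ => ?_, fun h => ⟨_, h⟩⟩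
    induction j with
    | zero => have := hdl 0 v hj; omega
    | succ j ih =>
      rcases hds j v hj with h' | h'
      · exact ih h'
      · rwa [show i = j by omega]
  -- A node is new in only one stage, and then has exactly one transmitting neighbour; so the
  -- transmitter for which `w` was chosen must be `v`.
  have hsw : ∀ i, ∀ v ∈ dom i, ∀ w, lvl w = i + 1 → G.Adj v w → (l w).stay = true →
      v ∈ dom (i + 1) ∧ w = stayer i v := by
    intro i v hv w hw ha hs
    rw [(hl w (hne w i hw)).2.1, hstay] at hs
    obtain ⟨j, v', hv', rfl⟩ := hs
    obtain ⟨h1, h2⟩ := hst j v' hv'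
    have hij : i = j := by
      have := (lvl_eq_iff _ j).mpr h1
      omega
    subst hij
    rw [Finset.mem_inter] at hv'
    obtain ⟨u, -, hu⟩ := (mem_newly.mp h1).2
    have : v = v' := (hu v ⟨hv, ha⟩).trans (hu v' ⟨hv'.1, h2⟩).symm
    subst this
    exact ⟨hv'.2, rfl⟩
  have hlast : dom (M + 1) = ∅ := hd.dom_eq_empty hspec
  have hsl : ∀ w, lvl w = M + 1 → (l w).stay = false := by
    intro w hw
    by_contra hs
    rw [Bool.not_eq_false] at hs
    have hv := hpar w (hne w M hw)
    rw [hw] at hv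
    have := (hsw M (par w) hv.1.1 w hw hv.1.2 hs).1
    simp [hlast] at this
  have hlz : lvl z = M + 1 := by
    rw [lvl_eq_iff]
    have h1 : z ∈ informed G r dom (M + 1) := hspec ▸ Finset.mem_univ z
    rw [mem_informed_succ] at h1
    exact h1.resolve_left fun h' => hMne (hz M h')
  have hzr : z ≠ r := hne z M hlz
  have hjz : join z = false := by
    rw [← Bool.not_eq_true, hjoin, hjl M z hlz, hlast]
    simp
  have hsz := hsl z hlz
  refine ⟨lvl, dom, par, M, z, ?_, lvl_zero, ?_, hdl, ?_, hds, ?_, ?_, ?_, ?_, ?_, hlast, hsl, ?_, ?_,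
    ?_, hlz, ?_⟩
  -- Apart from `r`, only `z` has `ack`, and its `join` bit is `0` since `dom (M + 1)` is empty. So
  -- `111` occurs only at `r`.
  · intro v
    by_cases hv : v = r
    · rw [hv]; simp [Label.isCoordinator, hr]
    · simp only [Label.isCoordinator, hl v hv, hv, iff_false, Bool.and_eq_true, not_and, hack]
      rintro ⟨hj, -⟩ hvz
      rw [hvz, hjz] at hj
      exact absurd hj (by simp)
  · intro v; rw [lvl_le_iff, hspec]; exact Finset.mem_univ v
  · intro v; simp [hd.zero]
  · intro i v hv
    have := (hpar v (hne v i hv)).1.1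
    rwa [hv] at this
  · exact fun v hv => (hpar v hv).1.2.symm
  · intro i v u hv hu ha
    refine (hpar v (hne v i hv)).2 u ⟨?_, ha.symm⟩
    rwa [hv]
  · rintro i v hv ⟨u, hu, ha, huu⟩
    have h1 : v ∉ newAt G r dom i := by
      rw [← lvl_eq_iff]; omega
    have h2 : v ∉ informed G r dom i := by
      rw [← lvl_le_iff]; omega
    exact h1 (mem_newly.mpr ⟨mem_frontier.mpr ⟨h2, u, hd.subset_informed i hu, ha.symm⟩, u,
      ⟨hu, ha.symm⟩, fun u' hu' => huu u' hu'.1 hu'.2.symm⟩)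
  · intro i v hv
    rw [(hl v (hne v i hv)).1, hjoin, hjl i v hv]
  · intro i v hv hv'
    obtain ⟨h1, h2⟩ := hst i v (Finset.mem_inter.mpr ⟨hv, hv'⟩)
    have h3 := (lvl_eq_iff _ _).mpr h1
    refine ⟨stayer i v, h3, h2, ?_⟩
    rw [(hl _ (hne _ i h3)).2.1, hstay]
    exact ⟨i, v, Finset.mem_inter.mpr ⟨hv, hv'⟩, rfl⟩
  · exact fun i v hv w hw ha hs => (hsw i v hv w hw ha hs).1
  · intro i v hv w hw ha hs w' hw' ha' hs'
    rw [(hsw i v hv w hw ha hs).2, (hsw i v hv w' hw' ha' hs').2]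
  · intro v
    by_cases hv : v = r
    · subst hv; simp [Label.isAcknowledger, hr, hzr.symm]
    · rw [Label.isAcknowledger, (hl v hv).2.2]
      constructor
      · intro h
        rw [Bool.and_eq_true] at h
        exact (hack v).mp h.2
      · rintro rfl
        rw [hsz, (hl v hv).1, hjz, (hack v).mpr rfl]
        rfl

end

/-! ### Bookkeeping of a single node -/

namespace NodeState

variable {l : Label} {src : Option Bits} {S : NodeState} {h : Option Msg}

/-- Because stamps show the sender's current round, adopting one amounts to counting the round
oneself once clocks agree; this keeps `Sync` invariant. -/
theorem stamp_of_action {c : Content} {τ : ℕ} (ha : S.action l src = some (.data c τ)) :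
    τ = S.clock + 1 := by
  unfold action at ha
  split at ha
  · simp at ha
  · split_ifs at ha; simp at ha
  · obtain ⟨⟨c', e⟩, -, hp⟩ := Option.bind_eq_some_iff.mp ha
    unfold broadcastAction at hp
    split_ifs at hp <;> first
      | simp at hp; done
      | (simp at hp; exact hp.2.symm)
      | (split at hp <;> (try split_ifs at hp) <;> simp at hp <;> exact hp.2.symm)

theorem clock_receive (hh : ∀ c τ, h = some (.data c τ) → τ = S.clock + 1) :
    (S.receive l src h).clock = S.clock + 1 := by
  rcases h with _ | ⟨c, τ⟩ | _ | ⟨τ, β⟩ | K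
  · rfl
  · have := hh c τ rfl
    simp only [receive]
    split_ifs
    · exact this
    · rfl
  · rfl
  · simp only [receive]
    split_ifs
    · cases β <;> rfl
    · rfl
  · rfl

theorem receive_of_new {c : Content} {τ : ℕ} (hl : l.isCoordinator = false)
    (hc : S.inf.map Prod.fst ≠ some c) :
    (S.receive l src (some (.data c τ))).inf = some (c, τ) ∧
    (S.receive l src (some (.data c τ))).sent = ∅ := by
  simp [receive, hl, hc]

theorem receive_of_ack {τ : ℕ} {β : AckBody} (hl : l.isCoordinator = true) (hτ : τ ∈ S.sent)
    (hβ : ∀ m, β ≠ .round m) :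
    (S.receive l src (some (.ack τ β))).inf = S.inf ∧
    (S.receive l src (some (.ack τ β))).acked = true ∧
    (S.receive l src (some (.ack τ β))).sent = match S.action l src with
        | some (.data _ _) => insert (S.clock + 1) S.sent
        | _ => S.sent := by
  cases β with
  | round m => exact absurd rfl (hβ m)
  | plain => simp [receive, hl, hτ]
  | sourceMsg x => simp [receive, hl, hτ]

theorem receive_of_ack_round {τ m : ℕ} (hl : l.isCoordinator = true) (hτ : τ ∈ S.sent) :
    (S.receive l src (some (.ack τ (.round m)))).inf = some (.bound m, S.clock + 1) ∧
    (S.receive l src (some (.ack τ (.round m)))).sent = ∅ ∧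
    (S.receive l src (some (.ack τ (.round m)))).acked = true := by
  simp [receive, hl, hτ]

theorem receive_ordinary (h1 : l.isCoordinator = false → ∀ c τ, h = some (.data c τ) →
      S.inf.map Prod.fst = some c)
    (h2 : l.isCoordinator = true → ∀ τ β, h = some (.ack τ β) → τ ∉ S.sent) :
    (S.receive l src h).inf = S.inf ∧ (S.receive l src h).acked = S.acked ∧
    (S.receive l src h).sent = match S.action l src with
        | some (.data _ _) => insert (S.clock + 1) S.sent
        | _ => S.sent := by
  rcases h with _ | ⟨c, τ⟩ | _ | ⟨τ, β⟩ | K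
  · exact ⟨rfl, rfl, rfl⟩
  · simp only [receive]
    rw [if_neg]
    · exact ⟨rfl, rfl, rfl⟩
    · rintro ⟨h3, h4⟩
      exact h4 (h1 h3 c τ rfl)
  · exact ⟨rfl, rfl, rfl⟩
  · simp only [receive]
    rw [if_neg]
    · exact ⟨rfl, rfl, rfl⟩
    · rintro ⟨h3, h4⟩
      exact h2 h3 τ β rfl h4
  · exact ⟨rfl, rfl, rfl⟩

end NodeState

/-! ### Broadcast in the network -/

section Broadcast

variable {V : Type*} {G : SimpleGraph V} {r : V} {l : V → Label} {lvl : V → ℕ}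
  {dom : ℕ → Finset V} {par : V → V} {M : ℕ} {z : V} {src : V → Option Bits}

/-- All nodes execute the same subroutine, with the same parameter, and agree on the round. -/
def Sync (st : Stage) (B t : ℕ) (S : V → NodeState) : Prop :=
  ∀ v, (S v).stage = st ∧ (S v).bound = B ∧ (S v).clock = t

theorem Sync.rstep {st : Stage} {B t : ℕ} {S : V → NodeState} (h : Sync st B t S) :
    Sync st B (t + 1) (rstep G l src S) := by
  refine fun v => ⟨by simp [RadioKB.rstep, (h v).1], by simp [RadioKB.rstep, (h v).2.1], ?_⟩
  rw [← (h v).2.2]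
  refine NodeState.clock_receive fun c τ hc => ?_
  obtain ⟨-, w, -, hw, -⟩ := exists_of_hear_eq_some hc
  rw [NodeState.stamp_of_action hw, (h v).2.2, (h w).2.2]

/-- The subroutines that consist of broadcasts and acknowledgements. -/
def Stage.IsBroadcast (st : Stage) : Prop := st ≠ .terminated ∧ st ≠ .roundRobinCollect

theorem NodeState.action_eq {l : Label} {src : Option Bits} {S : NodeState}
    (hs : S.stage.IsBroadcast) : S.action l src =
      S.inf.bind (fun p => broadcastAction l src S p.1 p.2 (S.clock + 1)) := by
  unfold action
  split
  · exact absurd ‹_› hs.1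
  · exact absurd ‹_› hs.2
  · rfl

/-- A node that has not been informed of `c`, and does not transmit before it is. -/
def Quiet (l : Label) (c : Content) (S : NodeState) : Prop :=
  S.inf = none ∨ (c ≠ .init ∧ ∃ e, S.inf = some (.init, e) ∧ e + 1 ≤ S.clock ∧
    (l.join = true → e + 2 ≤ S.clock) ∧
    (∀ τ ∈ S.sent, τ + 1 ≤ S.clock) ∧
    (S.heard = some .stay → ∀ τ ∈ S.sent, τ + 2 ≤ S.clock) ∧
    ∀ τ β, S.heard = some (.ack τ β) → τ ∉ S.sent)

namespace Quiet

variable {c : Content} {l : Label} {src : Option Bits} {S : NodeState}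

theorem inf_ne (h : Quiet l c S) : S.inf.map Prod.fst ≠ some c := by
  rcases h with h | ⟨hc, e, h, -⟩
  · simp [h]
  · simpa [h] using hc.symm

theorem action_eq_none (h : Quiet l c S) (hs : S.stage.IsBroadcast) (hl : l.isCoordinator = false) :
    S.action l src = none := by
  rw [NodeState.action_eq hs]
  rcases h with h | ⟨-, e, h, he, hj, h1, h2, h3⟩
  · simp [h]
  · rw [h, Option.bind_some, NodeState.broadcastAction, if_neg (by simp [hl]),
      if_neg (by omega), if_neg fun h' => by have := hj h'.1; omega]
    split
    · rename_i hh
      rw [if_neg]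
      intro h4
      have := h2 hh _ h4
      omega
    · rename_i τ β hh
      rw [if_neg (h3 τ β hh)]
    · rw [NodeState.startsAck, if_neg (by omega)]
      rfl

/-- Leftovers of "init" are harmless: a "stay" triggers a repetition only of a message sent in the
round just before it was heard, and the stale transmissions are older than that. -/
theorem receive (h : Quiet l c S) (hs : S.stage.IsBroadcast) (hl : l.isCoordinator = false)
    {m : Option Msg} (hm : m = none ∨ m = some .stay) : Quiet l c (S.receive l src m) := by
  have ha := h.action_eq_none (src := src) hs hl
  obtain ⟨h1, -, h3⟩ := NodeState.receive_ordinary (l := l) (src := src) (S := S) (h := m)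
    (fun _ c τ h' => by rcases hm with rfl | rfl <;> simp at h') (fun h' => by simp [hl] at h')
  have h4 : (S.receive l src m).clock = S.clock + 1 := NodeState.clock_receive
    (fun c τ h' => by rcases hm with rfl | rfl <;> simp at h')
  simp only [ha] at h3
  unfold Quiet
  rw [h1, h3, h4, NodeState.heard_receive]
  rcases h with h | ⟨hc, e, h, he, hj, h5, -, -⟩
  · exact .inl h
  · refine .inr ⟨hc, e, h, by omega, fun h' => (hj h').trans (Nat.le_succ _), fun τ hτ => ?_, fun _ τ hτ => ?_, fun τ β h' => ?_⟩
    · have := h5 τ hτ; omega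
    · have := h5 τ hτ; omega
    · rcases hm with rfl | rfl <;> simp at h'

end Quiet

/-- No informed node starts an acknowledgement in round `t`. -/
def NoAckStart (r : V) (l : V → Label) (src : V → Option Bits) (lvl : V → ℕ) (B : ℕ) (c : Content)
    (b t : ℕ) : Prop :=
  ∀ v ≠ r, ∀ S : NodeState, S.bound = B →
    S.startsAck (l v) (src v) c (b + (2 * lvl v - 1)) t = none

/-- The state of the network just before stage `i` of a broadcast of `c`, where the coordinator
first transmits in round `b + 1`. -/
structure BeforeData (r : V) (l : V → Label) (lvl : V → ℕ) (dom : ℕ → Finset V) (st : Stage) (B : ℕ) (a : Bool)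
    (c : Content) (b i : ℕ) (S : V → NodeState) : Prop where
  sync : Sync st B (b + 2 * i) S
  acked : (S r).acked = a
  quiet : ∀ v, i < lvl v → Quiet (l v) c (S v)
  inf : ∀ v, lvl v ≤ i → (S v).inf = some (c, b + (2 * lvl v - 1))
  sent : ∀ v, lvl v ≤ i → ∀ τ, τ ∈ (S v).sent ↔ ∃ i' < i, v ∈ dom i' ∧ τ = b + 2 * i' + 1
  heard_stay : ∀ i', i = i' + 1 → ∀ v ∈ dom i', (S v).heard = some .stay ↔ v ∈ dom i
  heard_ack : ∀ v, lvl v ≤ i → v ≠ r → ∀ τ β, (S v).heard ≠ some (.ack τ β)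

/-- The state of the network after the nodes in `dom i` have transmitted. -/
structure AfterData (r : V) (l : V → Label) (lvl : V → ℕ) (dom : ℕ → Finset V) (st : Stage) (B : ℕ) (a : Bool)
    (c : Content) (b i : ℕ) (S : V → NodeState) : Prop where
  sync : Sync st B (b + 2 * i + 1) S
  acked : (S r).acked = a
  quiet : ∀ v, i + 1 < lvl v → Quiet (l v) c (S v)
  inf : ∀ v, lvl v ≤ i + 1 → (S v).inf = some (c, b + (2 * lvl v - 1))
  sent : ∀ v, lvl v ≤ i + 1 → ∀ τ, τ ∈ (S v).sent ↔ ∃ i' < i + 1, v ∈ dom i' ∧ τ = b + 2 * i' + 1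
  heard : ∀ v, lvl v ≤ i + 1 → (S v).heard ≠ some .stay ∧ ∀ τ β, (S v).heard ≠ some (.ack τ β)

/-- The state of the network after a broadcast of `c`, before a round in which the nodes transmit
the messages `tx`. -/
structure Informed (r : V) (l : V → Label) (src : V → Option Bits) (lvl : V → ℕ)
    (dom : ℕ → Finset V) (st : Stage) (B : ℕ) (a : Bool) (c : Content) (b t : ℕ)
    (tx : V → Option Msg) (S : V → NodeState) : Prop where
  sync : Sync st B t S
  acked : (S r).acked = a
  inf : ∀ v, (S v).inf = some (c, b + (2 * lvl v - 1))
  sent : ∀ v, ∀ τ, τ ∈ (S v).sent ↔ ∃ i, v ∈ dom i ∧ τ = b + 2 * i + 1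
  action : ∀ v, (S v).action (l v) (src v) = tx v

variable (hS : Schedule G r l lvl dom par M z)

namespace Schedule
include hS

theorem coord_eq_false {v : V} (hv : v ≠ r) : (l v).isCoordinator = false := by
  rw [← Bool.not_eq_true, hS.coord]; exact hv

theorem coord_eq_true : (l r).isCoordinator = true := (hS.coord r).mpr rfl

theorem lvl_r : lvl r = 0 := (hS.lvl_eq_zero r).mpr rfl

theorem lvl_pos {v : V} (hv : v ≠ r) : 0 < lvl v :=
  Nat.pos_of_ne_zero fun h => hv ((hS.lvl_eq_zero v).mp h)

theorem ne_of_lvl {v : V} {i : ℕ} (hv : i < lvl v) : v ≠ r := by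
  rintro rfl; rw [hS.lvl_r] at hv; omega

/-- Once empty, the transmitting sets remain empty, as no node is first informed after stage `M`. -/
theorem lt_of_dom {i : ℕ} {v : V} (hv : v ∈ dom i) : i ≤ M := by
  by_contra! hi
  have : ∀ k, dom (M + 1 + k) = ∅ := by
    intro k
    induction k with
    | zero => exact hS.dom_last
    | succ k ih =>
      rw [← add_assoc]
      by_contra hne
      obtain ⟨u, hu⟩ := Finset.nonempty_iff_ne_empty.mpr hne
      rcases hS.dom_succ _ u hu with h | h
      · simp [ih] at h
      · have := hS.lvl_le u; omega
  have h2 := this (i - (M + 1))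
  rw [show M + 1 + (i - (M + 1)) = i by omega] at h2
  simp [h2] at hv

theorem lvl_par_lt {v : V} (hv : v ≠ r) : lvl (par v) < lvl v := by
  have := hS.lvl_pos hv
  have := hS.lvl_le_of_dom (lvl v - 1) _ (hS.par_mem (lvl v - 1) v (by omega))
  omega

/-- Exactly the parent of the sender recognizes an acknowledgement. -/
theorem mem_sent_iff {st : Stage} {B : ℕ} {a : Bool} {c : Content} {b t : ℕ} {S : V → NodeState}
    {u : V} {tx : V → Option Msg} (h : Informed r l src lvl dom st B a c b t tx S)
    (hu : u ≠ r) {v : V} (hv : G.Adj v u) :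
    b + (2 * lvl u - 1) ∈ (S v).sent ↔ v = par u := by
  have hpos := hS.lvl_pos hu
  rw [h.sent]
  constructor
  · rintro ⟨i, hi, h1⟩
    exact hS.eq_par i u v (by omega) hi hv.symm
  · rintro rfl
    exact ⟨lvl u - 1, hS.par_mem _ u (by omega), by omega⟩

variable {st : Stage} (hst : st.IsBroadcast) {B : ℕ} {a : Bool} {c : Content} {b : ℕ}
  {S : V → NodeState}
include hst

/-- The local rule reproduces `dom i`: by `dom_succ` a transmitter either was informed in the
preceding stage, and is recognized by `join`, or transmitted in the preceding stage, and is
recognized by the "stay" it heard. The coordinator's first transmission comes from its own initial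
rule. -/
theorem action_beforeData {i : ℕ} (h : BeforeData r l lvl dom st B a c b i S)
    (hn : NoAckStart r l src lvl B c b (b + 2 * i + 1)) (v : V) :
    (v ∈ dom i → (S v).action (l v) (src v) = some (.data c (b + 2 * i + 1))) ∧
    (v ∉ dom i → (S v).action (l v) (src v) = none) := by
  obtain ⟨hs, hB, hc⟩ := h.sync v
  have hact := NodeState.action_eq (l := l v) (src := src v) (S := S v) (by rw [hs]; exact hst)
  rcases le_or_gt (lvl v) i with hv | hv
  swap
  · refine ⟨fun hd => ?_, fun _ => ?_⟩
    · have := hS.lvl_le_of_dom i v hd; omega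
    · exact (h.quiet v hv).action_eq_none (by rw [hs]; exact hst)
        (hS.coord_eq_false (hS.ne_of_lvl hv))
  rw [hact, h.inf v hv, Option.bind_some, hc, NodeState.broadcastAction]
  have hstay : ((S v).heard = some .stay ∧ b + 2 * i + 1 - 2 ∈ (S v).sent) → v ∈ dom i := by
    rintro ⟨h1, h2⟩
    obtain ⟨i', hi', hd, ht⟩ := (h.sent v hv _).mp h2
    exact (h.heard_stay i' (by omega) v hd).mp h1
  have hstay' : ∀ i', i = i' + 1 → v ∈ dom i' → v ∈ dom i →
      ((S v).heard = some .stay ∧ b + 2 * i + 1 - 2 ∈ (S v).sent) := by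
    intro i' hi hd hd'
    refine ⟨(h.heard_stay i' hi v hd).mpr hd', (h.sent v hv _).mpr ⟨i', by omega, hd, by omega⟩⟩
  by_cases hvr : v = r
  · subst hvr
    -- Truncated subtraction gives `2 * lvl r - 1 = 0`: the coordinator counts as informed in round
    -- `b` and first transmits in round `b + 1`.
    rw [if_pos hS.coord_eq_true, hS.lvl_r]
    cases i with
    | zero =>
      have := (hS.dom_zero v).mpr rfl
      simp [this]
    | succ i =>
      rw [if_neg (by omega)]
      have h3 := hS.dom_succ i v
      rw [hS.lvl_r] at h3
      refine ⟨fun hd => ?_, fun hd => ?_⟩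
      · rw [if_pos (hstay' i rfl ((h3 hd).resolve_right (by omega)) hd)]
      · rw [if_neg fun h' => hd (hstay h')]
  · have hpos := hS.lvl_pos hvr
    rw [if_neg (by simp [hS.coord_eq_false hvr]), if_neg (by omega)]
    by_cases hj : (l v).join = true ∧ b + 2 * i + 1 = b + (2 * lvl v - 1) + 2
    · rw [if_pos hj]
      obtain ⟨hj, ht⟩ := hj
      have h3 := hS.join_iff (lvl v - 1) v (by omega)
      rw [show lvl v - 1 + 1 = i by omega] at h3
      refine ⟨fun _ => rfl, fun hd => absurd (h3.mp hj) hd⟩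
    · rw [if_neg hj]
      have hprev : v ∈ dom i → ∃ i', i = i' + 1 ∧ v ∈ dom i' := by
        intro hd
        cases i with
        | zero => omega
        | succ i =>
          refine ⟨i, rfl, (hS.dom_succ i v hd).resolve_right fun h3 => hj ⟨?_, by omega⟩⟩
          exact (hS.join_iff i v h3).mpr hd
      refine ⟨fun hd => ?_, fun hd => ?_⟩
      · obtain ⟨i', hi', hd'⟩ := hprev hd
        obtain ⟨h3, h4⟩ := hstay' i' hi' hd' hd
        simp only [h3, if_pos h4]
      · split
        · rename_i hh
          rw [if_neg fun h4 => hd (hstay ⟨hh, h4⟩)]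
        · rename_i τ β hh
          exact absurd hh (h.heard_ack v hv hvr τ β)
        · rw [hn v hvr _ hB]
          rfl

/-- As exactly `dom i` transmits, nodes of level `i + 1` hear their parent, while by `not_unique`
nodes of higher level meet silence or a collision. -/
theorem beforeData_rstep {i : ℕ} (h : BeforeData r l lvl dom st B a c b i S)
    (hn : NoAckStart r l src lvl B c b (b + 2 * i + 1)) :
    AfterData r l lvl dom st B a c b i (rstep G l src S) := by
  have hact := hS.action_beforeData hst h hn
  set tx : V → Option Msg := fun w => (S w).action (l w) (src w) with htx
  have hsome : ∀ w m, tx w = some m → w ∈ dom i ∧ m = .data c (b + 2 * i + 1) := by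
    intro w m hw
    by_cases hd : w ∈ dom i
    · have := (hact w).1 hd
      simp only [htx, this] at hw
      exact ⟨hd, (Option.some_inj.mp hw).symm⟩
    · simp [htx, (hact w).2 hd] at hw
  have hhear : ∀ v m, hear G tx v = some m → m = .data c (b + 2 * i + 1) := by
    intro v m hm
    obtain ⟨-, w, -, hw, -⟩ := exists_of_hear_eq_some hm
    exact (hsome w m hw).2
  have hnone : ∀ v, i + 1 < lvl v → hear G tx v = none := by
    intro v hv
    by_contra hne
    obtain ⟨m, hm⟩ := Option.ne_none_iff_exists'.mp hne
    obtain ⟨-, w, hw1, hw2, hw3⟩ := exists_of_hear_eq_some hm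
    refine hS.not_unique i v hv ⟨w, (hsome w m hw2).1, hw1, fun u hu ha => hw3 u ha ?_⟩
    simp [htx, (hact u).1 hu]
  have hnew : ∀ v, lvl v = i + 1 → hear G tx v = some (.data c (b + 2 * i + 1)) := by
    intro v hv
    have hvr := hS.ne_of_lvl (v := v) (i := i) (by omega)
    refine hear_eq_some ?_ (hS.adj_par v hvr) ((hact _).1 (hS.par_mem i v hv)) ?_
    · refine (hact v).2 fun hd => ?_
      have := hS.lvl_le_of_dom i v hd
      omega
    · intro w hw hs
      obtain ⟨m, hm⟩ := Option.isSome_iff_exists.mp hs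
      exact hS.eq_par i v w hv (hsome w m hm).1 hw
  have hord : ∀ v, lvl v ≤ i → (rstep G l src S v).inf = (S v).inf ∧
      (rstep G l src S v).acked = (S v).acked ∧
      (rstep G l src S v).sent = match (S v).action (l v) (src v) with
        | some (.data _ _) => insert ((S v).clock + 1) (S v).sent
        | _ => (S v).sent := by
    intro v hv
    refine NodeState.receive_ordinary (fun _ c' τ hh => ?_) (fun _ τ β hh => ?_)
    · have := hhear v _ hh
      simp only [Msg.data.injEq] at this
      rw [h.inf v hv, this.1]; rfl
    · have := hhear v _ hh
      simp at this
  refine ⟨h.sync.rstep, ?_, fun v hv => ?_, fun v hv => ?_, fun v hv τ => ?_, fun v hv => ?_⟩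
  · rw [(hord r (by rw [hS.lvl_r]; omega)).2.1, h.acked]
  · refine (h.quiet v (by omega)).receive (by rw [(h.sync v).1]; exact hst)
      (hS.coord_eq_false (hS.ne_of_lvl hv)) (.inl (hnone v hv))
  · rcases hv.lt_or_eq with hv' | hv'
    · rw [(hord v (by omega)).1, h.inf v (by omega)]
    · have hvr := hS.ne_of_lvl (v := v) (i := i) (by omega)
      have := (NodeState.receive_of_new (src := src v) (τ := b + 2 * i + 1)
        (hS.coord_eq_false hvr) (h.quiet v (by omega)).inf_ne).1
      rw [rstep, hnew v hv', this, hv']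
      simp; omega
  · rcases hv.lt_or_eq with hv' | hv'
    · rw [(hord v (by omega)).2.2]
      by_cases hd : v ∈ dom i
      · rw [(hact v).1 hd]
        simp only [Finset.mem_insert, h.sent v (by omega), (h.sync v).2.2]
        constructor
        · rintro (rfl | ⟨i', hi', h1, h2⟩)
          · exact ⟨i, by omega, hd, rfl⟩
          · exact ⟨i', by omega, h1, h2⟩
        · rintro ⟨i', hi', h1, h2⟩
          rcases (Nat.lt_succ_iff.mp hi').lt_or_eq with h3 | rfl
          · exact .inr ⟨i', h3, h1, h2⟩
          · exact .inl h2
      · rw [(hact v).2 hd]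
        simp only [h.sent v (show lvl v ≤ i by omega)]
        constructor
        · rintro ⟨i', hi', h1, h2⟩
          exact ⟨i', by omega, h1, h2⟩
        · rintro ⟨i', hi', h1, h2⟩
          rcases (Nat.lt_succ_iff.mp hi').lt_or_eq with h3 | rfl
          · exact ⟨i', h3, h1, h2⟩
          · exact absurd h1 hd
    · have hvr := hS.ne_of_lvl (v := v) (i := i) (by omega)
      have := (NodeState.receive_of_new (src := src v) (τ := b + 2 * i + 1)
        (hS.coord_eq_false hvr) (h.quiet v (by omega)).inf_ne).2
      rw [rstep, hnew v hv', this]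
      -- A newly informed node has not transmitted yet: it belongs to `dom i'` only for `i' ≥ lvl v
      -- = i + 1`.
      simp only [Finset.notMem_empty, false_iff]
      rintro ⟨i', hi', h1, -⟩
      have := hS.lvl_le_of_dom i' v h1
      omega
  · rw [rstep, NodeState.heard_receive]
    constructor
    · intro hh
      have := hhear v _ hh
      simp at this
    · intro τ β hh
      have := hhear v _ hh
      simp at this

/-- The action of an informed node in a round of a broadcast in which it does not transmit the
broadcast message. -/
theorem broadcastAction_afterData [DecidableEq V] {i : ℕ} (h : AfterData r l lvl dom st B a c b i S) (v : V)
    (hv : lvl v ≤ i + 1) : (S v).action (l v) (src v) =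
      if lvl v = i + 1 ∧ (l v).stay = true then some .stay
      else if v = r then none
      else ((S v).startsAck (l v) (src v) c (b + (2 * lvl v - 1)) (b + 2 * i + 2)).map
        (.ack (b + (2 * lvl v - 1))) := by
  obtain ⟨hs, hB, hc⟩ := h.sync v
  obtain ⟨hh1, hh2⟩ := h.heard v hv
  rw [NodeState.action_eq (by rw [hs]; exact hst), h.inf v hv, Option.bind_some, hc,
    NodeState.broadcastAction]
  by_cases hvr : v = r
  · subst hvr
    rw [if_pos hS.coord_eq_true, hS.lvl_r, if_neg (by omega), if_neg (fun h => hh1 h.1),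
      if_neg (by omega), if_pos rfl]
  · have hpos := hS.lvl_pos hvr
    rw [if_neg (by simp [hS.coord_eq_false hvr]), if_neg hvr]
    by_cases hst : lvl v = i + 1 ∧ (l v).stay = true
    · rw [if_pos ⟨hst.2, by omega⟩, if_pos hst]
    · rw [if_neg fun h => hst ⟨by omega, h.1⟩, if_neg (by omega), if_neg hst]
      split
      · exact absurd ‹_› hh1
      · exact absurd ‹_› (hh2 _ _)
      · rfl

/-- In the second round of a stage only nodes of level `i + 1` with `stay` transmit. Each `v ∈ dom
i` has at most one such neighbour, and has one precisely if it transmits again. -/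
theorem afterData_rstep [DecidableEq V] {i : ℕ} (h : AfterData r l lvl dom st B a c b i S)
    (hn : NoAckStart r l src lvl B c b (b + 2 * i + 2)) :
    BeforeData r l lvl dom st B a c b (i + 1) (rstep G l src S) := by
  set tx : V → Option Msg := fun w => (S w).action (l w) (src w) with htx
  have hpos : ∀ w, lvl w = i + 1 → (l w).stay = true → tx w = some .stay := by
    intro w hw hs
    simp only [htx, hS.broadcastAction_afterData hst h w hw.le]
    rw [if_pos ⟨hw, hs⟩]
  have hneg : ∀ w, ¬ (lvl w = i + 1 ∧ (l w).stay = true) → tx w = none := by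
    intro w hw
    rcases le_or_gt (lvl w) (i + 1) with hle | hgt
    · simp only [htx, hS.broadcastAction_afterData hst h w hle]
      rw [if_neg hw]
      split_ifs with hr
      · rfl
      · rw [hn w hr _ (h.sync w).2.1]; rfl
    · exact (h.quiet w hgt).action_eq_none (by rw [(h.sync w).1]; exact hst)
        (hS.coord_eq_false (hS.ne_of_lvl hgt))
  have hsome : ∀ w m, tx w = some m → (lvl w = i + 1 ∧ (l w).stay = true) ∧ m = .stay := by
    intro w m hm
    by_cases hw : lvl w = i + 1 ∧ (l w).stay = true
    · rw [hpos w hw.1 hw.2] at hm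
      exact ⟨hw, (Option.some_inj.mp hm).symm⟩
    · simp [hneg w hw] at hm
  have hhear : ∀ v m, hear G tx v = some m → m = .stay := by
    intro v m hm
    obtain ⟨-, w, -, hw, -⟩ := exists_of_hear_eq_some hm
    exact (hsome w m hw).2
  have hhear' : ∀ v, hear G tx v = none ∨ hear G tx v = some .stay := by
    intro v
    cases hm : hear G tx v with
    | none => exact .inl rfl
    | some m => exact .inr (congrArg some (hhear v m hm))
  have hord : ∀ v, lvl v ≤ i + 1 → (rstep G l src S v).inf = (S v).inf ∧
      (rstep G l src S v).acked = (S v).acked ∧ (rstep G l src S v).sent = (S v).sent := by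
    intro v hv
    obtain ⟨h1, h2, h3⟩ := NodeState.receive_ordinary (l := l v) (src := src v) (S := S v)
      (h := hear G tx v) (fun _ c' τ hh => by simpa using hhear v _ hh)
      (fun _ τ β hh => by simpa using hhear v _ hh)
    refine ⟨h1, h2, h3.trans ?_⟩
    split
    · rename_i hh
      simpa using (hsome v _ hh).2
    · rfl
  refine ⟨h.sync.rstep, ?_, fun v hv => ?_, fun v hv => ?_, fun v hv τ => ?_, ?_, fun v hv _ τ β => ?_⟩
  · rw [(hord r (by rw [hS.lvl_r]; omega)).2.1, h.acked]
  · exact (h.quiet v hv).receive (by rw [(h.sync v).1]; exact hst)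
      (hS.coord_eq_false (hS.ne_of_lvl hv)) (hhear' v)
  · rw [(hord v hv).1, h.inf v hv]
  · rw [(hord v hv).2.2, h.sent v hv]
  · intro i' hi' v hv
    obtain rfl : i = i' := by omega
    have hlv := hS.lvl_le_of_dom i v hv
    rw [rstep, NodeState.heard_receive]
    constructor
    · intro hm
      obtain ⟨-, w, hw1, hw2, -⟩ := exists_of_hear_eq_some hm
      obtain ⟨h1, h2⟩ := (hsome w _ hw2).1
      exact hS.stay_dom i v hv w h1 hw1 h2
    · intro hd
      obtain ⟨w, h1, h2, h3⟩ := hS.stay_exists i v hv hd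
      refine hear_eq_some (hneg v (by omega)) h2 (hpos w h1 h3) fun w' h4 h5 => ?_
      obtain ⟨m, hm⟩ := Option.isSome_iff_exists.mp h5
      obtain ⟨h6, h7⟩ := (hsome w' m hm).1
      exact hS.stay_unique i v hv w h1 h2 h3 w' h6 h4 h7
  · rw [rstep, NodeState.heard_receive]
    intro hh
    simpa using hhear v _ hh

/-- The course of a broadcast. -/
theorem broadcast [DecidableEq V] (h : BeforeData r l lvl dom st B a c b 0 S)
    (hn : ∀ t ≤ b + 2 * M + 1, NoAckStart r l src lvl B c b t) (i : ℕ) (hi : i ≤ M) :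
    BeforeData r l lvl dom st B a c b i ((rstep G l src)^[2 * i] S) ∧
    AfterData r l lvl dom st B a c b i ((rstep G l src)^[2 * i + 1] S) := by
  have key : ∀ i ≤ M, BeforeData r l lvl dom st B a c b i ((rstep G l src)^[2 * i] S) →
      AfterData r l lvl dom st B a c b i ((rstep G l src)^[2 * i + 1] S) := by
    intro i hi hb
    rw [Function.iterate_succ_apply']
    exact hS.beforeData_rstep hst hb (hn _ (by omega))
  suffices hb : BeforeData r l lvl dom st B a c b i ((rstep G l src)^[2 * i] S) from
    ⟨hb, key i hi hb⟩
  induction i with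
  | zero => exact h
  | succ i ih =>
    have := hS.afterData_rstep hst (key i (by omega) (ih (by omega))) (hn _ (by omega))
    rwa [← Function.iterate_succ_apply' (rstep G l src)] at this

/-- Up to the round in which a broadcast of `c` is completed, nodes know no broadcast messages
other than "init" and `c`. -/
theorem inf_broadcast [DecidableEq V] (h : BeforeData r l lvl dom st B a c b 0 S)
    (hn : ∀ t ≤ b + 2 * M + 1, NoAckStart r l src lvl B c b t) (j : ℕ) (hj : j ≤ 2 * M + 1) (v : V) :
    Sync st B (b + j) ((rstep G l src)^[j] S) ∧ (((rstep G l src)^[j] S v).inf = none ∨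
      ∃ e, ((rstep G l src)^[j] S v).inf = some (.init, e) ∨
        ((rstep G l src)^[j] S v).inf = some (c, e)) := by
  have hq : ∀ (l : Label) (S : NodeState), Quiet l c S → S.inf = none ∨
      ∃ e, S.inf = some (.init, e) ∨ S.inf = some (c, e) := by
    rintro l S (h | ⟨-, e, h, -⟩)
    · exact .inl h
    · exact .inr ⟨e, .inl h⟩
  rcases Nat.even_or_odd' j with ⟨i, rfl | rfl⟩
  · have := (hS.broadcast hst h hn i (by omega)).1
    refine ⟨this.sync, ?_⟩
    rcases le_or_gt (lvl v) i with hv | hv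
    · exact .inr ⟨_, .inr (this.inf v hv)⟩
    · exact hq _ _ (this.quiet v hv)
  · have := (hS.broadcast hst h hn i (by omega)).2
    refine ⟨this.sync, ?_⟩
    rcases le_or_gt (lvl v) (i + 1) with hv | hv
    · exact .inr ⟨_, .inr (this.inf v hv)⟩
    · exact hq _ _ (this.quiet v hv)

/-- No node of level `M + 1` has `stay`, so round `b + 2 M + 2` is the first one free of broadcast
traffic; `y` records who starts an acknowledgement in it. -/
theorem informed_of_afterData [DecidableEq V] (h : AfterData r l lvl dom st B a c b M S)
    (y : V → Option AckBody) (hr : y r = none)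
    (hy : ∀ v ≠ r, ∀ S : NodeState, S.bound = B →
      S.startsAck (l v) (src v) c (b + (2 * lvl v - 1)) (b + 2 * M + 2) = y v) :
    Informed r l src lvl dom st B a c b (b + 2 * M + 1)
      (fun v => (y v).map (.ack (b + (2 * lvl v - 1)))) S := by
  refine ⟨h.sync, h.acked, fun v => h.inf v (hS.lvl_le v), fun v τ => ?_, fun v => ?_⟩
  · rw [h.sent v (hS.lvl_le v)]
    constructor
    · rintro ⟨i, -, h⟩; exact ⟨i, h⟩
    · rintro ⟨i, h⟩; exact ⟨i, Nat.lt_succ_of_le (hS.lt_of_dom h.1), h⟩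
  · rw [hS.broadcastAction_afterData hst h v (hS.lvl_le v), if_neg]
    · split_ifs with hv
      · rw [hv, hr]; rfl
      · rw [hy v hv _ (h.sync v).2.1]
    · rintro ⟨h1, h2⟩
      simp [hS.stay_last v h1] at h2

/-- Once the broadcast is over, the only remaining reaction is to forward a recognized
acknowledgement. -/
theorem action_eq_of_informed {t : ℕ} {v : V} {S : NodeState} (hs : S.stage = st) (hB : S.bound = B)
    (hc : S.clock = t) (ht : b + 2 * M + 2 ≤ t) (hi : S.inf = some (c, b + (2 * lvl v - 1)))
    (hh : S.heard ≠ some .stay) (hn : NoAckStart r l src lvl B c b (t + 1)) :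
    (v = r → S.action (l v) (src v) = none) ∧
    (v ≠ r → (∀ τ β, S.heard = some (.ack τ β) → τ ∉ S.sent) → S.action (l v) (src v) = none) ∧
    (v ≠ r → ∀ τ β, S.heard = some (.ack τ β) → τ ∈ S.sent →
      S.action (l v) (src v) = some (.ack (b + (2 * lvl v - 1)) β)) := by
  rw [NodeState.action_eq (by rw [hs]; exact hst), hi, Option.bind_some, hc,
    NodeState.broadcastAction]
  have hlv := hS.lvl_le v
  by_cases hvr : v = r
  · refine ⟨fun _ => ?_, fun h => absurd hvr h, fun h => absurd hvr h⟩
    subst hvr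
    rw [if_pos hS.coord_eq_true, hS.lvl_r, if_neg (by omega), if_neg fun h => hh h.1]
  · have hpos := hS.lvl_pos hvr
    refine ⟨fun h => absurd h hvr, fun _ hτ => ?_, fun _ τ β h1 h2 => ?_⟩
    all_goals rw [if_neg (by simp [hS.coord_eq_false hvr]), if_neg (by omega), if_neg]
    · split
      · exact absurd ‹_› hh
      · rw [if_neg (hτ _ _ ‹_›)]
      · rw [hn v hvr S hB]; rfl
    -- This late, the `join` rule could apply only to a node of level `M + 1`, which would have to
    -- lie in the empty set `dom (M + 1)`.
    · rintro ⟨hj, h1⟩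
      rw [hS.join_iff (lvl v - 1) v (by omega), show lvl v - 1 + 1 = M + 1 by omega,
        hS.dom_last] at hj
      simp at hj
    · simp only [h1, if_pos h2]
    · rintro ⟨hj, h1⟩
      rw [hS.join_iff (lvl v - 1) v (by omega), show lvl v - 1 + 1 = M + 1 by omega,
        hS.dom_last] at hj
      simp at hj

theorem informed_idle {t : ℕ} (ht : b + 2 * M + 1 ≤ t)
    (h : Informed r l src lvl dom st B a c b t (fun _ => none) S)
    (hn : NoAckStart r l src lvl B c b (t + 2)) :
    Informed r l src lvl dom st B a c b (t + 1) (fun _ => none) (rstep G l src S) := by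
  have hh : ∀ v, hear G (fun w => (S w).action (l w) (src w)) v = none :=
    fun v => hear_eq_none fun w _ => h.action w
  have hord : ∀ v, (rstep G l src S v).inf = (S v).inf ∧
      (rstep G l src S v).acked = (S v).acked ∧ (rstep G l src S v).sent = (S v).sent := by
    intro v
    obtain ⟨h1, h2, h3⟩ := NodeState.receive_ordinary (l := l v) (src := src v) (S := S v)
      (h := none) (fun _ c' τ hh => by simp at hh) (fun _ τ β hh => by simp at hh)
    rw [h.action v] at h3
    rw [rstep, hh]
    exact ⟨h1, h2, h3⟩
  refine ⟨h.sync.rstep, ?_, fun v => ?_, fun v τ => ?_, fun v => ?_⟩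
  · rw [(hord r).2.1, h.acked]
  · rw [(hord v).1, h.inf]
  · rw [(hord v).2.2, h.sent]
  · obtain ⟨h1, h2, h3⟩ := h.sync.rstep (G := G) (l := l) (src := src) v
    have hhd : (rstep G l src S v).heard = none := by rw [rstep, NodeState.heard_receive, hh]
    obtain ⟨h4, h5, -⟩ := hS.action_eq_of_informed (src := src) hst h1 h2 h3 (by omega)
      ((hord v).1.trans (h.inf v)) (by simp [hhd]) hn
    by_cases hv : v = r
    · exact h4 hv
    · exact h5 hv (by simp [hhd])

theorem informed_idle_iterate {t : ℕ} (ht : b + 2 * M + 1 ≤ t)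
    (h : Informed r l src lvl dom st B a c b t (fun _ => none) S)
    (hn : ∀ t' ≥ t + 2, NoAckStart r l src lvl B c b t') (j : ℕ) :
    Informed r l src lvl dom st B a c b (t + j) (fun _ => none) ((rstep G l src)^[j] S) := by
  induction j with
  | zero => exact h
  | succ j ih =>
    rw [Function.iterate_succ_apply', ← add_assoc]
    exact hS.informed_idle hst (by omega) ih (hn _ (by omega))

end Schedule

end Broadcast

/-! ### Acknowledgements -/

section Acknowledgement

variable {V : Type*} [DecidableEq V] {G : SimpleGraph V} {r : V} {l : V → Label} {lvl : V → ℕ}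
  {dom : ℕ → Finset V} {par : V → V} {M : ℕ} {z : V} {src : V → Option Bits}

/-- Only `u` transmits, namely an acknowledgement for the round in which it was informed. -/
def ackFrom (lvl : V → ℕ) (b : ℕ) (u : V) (β : AckBody) (v : V) : Option Msg :=
  if v = u then some (.ack (b + (2 * lvl u - 1)) β) else none

theorem hear_ackFrom {b : ℕ} {u v : V} {β : AckBody} : hear G (ackFrom lvl b u β) v =
    haveI := Classical.propDecidable (G.Adj v u)
    if G.Adj v u then some (.ack (b + (2 * lvl u - 1)) β) else none := by
  have hne : ∀ w, w ≠ u → ackFrom lvl b u β w = none := fun w hw => by rw [ackFrom, if_neg hw]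
  split_ifs with h
  · refine hear_eq_some (hne v h.ne) h (by rw [ackFrom, if_pos rfl]) fun w _ hs => ?_
    by_contra hw
    simp [hne w hw] at hs
  · refine hear_eq_none fun w hw => hne w ?_
    rintro rfl
    exact h hw

namespace Schedule

variable (hS : Schedule G r l lvl dom par M z)
  {st : Stage} (hst : st.IsBroadcast) {B : ℕ} {a : Bool} {c : Content} {b t : ℕ}
  {S : V → NodeState} {u : V} {β : AckBody}
include hS

theorem rstep_ackFrom_of_ne (h : Informed r l src lvl dom st B a c b t (ackFrom lvl b u β) S)
    {v : V} (hv : v = r → ¬ (G.Adj v u ∧ b + (2 * lvl u - 1) ∈ (S v).sent)) :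
    (rstep G l src S v).inf = (S v).inf ∧ (rstep G l src S v).acked = (S v).acked ∧
      (rstep G l src S v).sent = (S v).sent := by
  have htx : (fun w => (S w).action (l w) (src w)) = ackFrom lvl b u β := funext h.action
  have hh : ∀ m, hear G (ackFrom lvl b u β) v = some m →
      G.Adj v u ∧ m = .ack (b + (2 * lvl u - 1)) β := by
    intro m hm
    rw [hear_ackFrom] at hm
    split_ifs at hm with h'
    exact ⟨h', (Option.some_inj.mp hm).symm⟩
  obtain ⟨h1, h2, h3⟩ := NodeState.receive_ordinary (l := l v) (src := src v) (S := S v)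
    (h := hear G (ackFrom lvl b u β) v) (fun _ c' τ hh' => by simpa using (hh _ hh').2)
    (fun hc τ β' hh' => by
      obtain ⟨h1, h2⟩ := hh _ hh'
      simp only [Msg.ack.injEq] at h2
      rw [h2.1]
      exact fun h3 => hv ((hS.coord v).mp hc) ⟨h1, h3⟩)
  rw [rstep, htx]
  refine ⟨h1, h2, h3.trans ?_⟩
  split
  · rename_i hh
    rw [h.action, ackFrom] at hh
    split_ifs at hh
    simp at hh
  · rfl

include hst in
-- The acknowledgement moves one step, because only the parent recognizes the round number. No
-- assumption is made on `par u`, so the lemma also describes the other nodes in the round in which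
-- the coordinator receives it.
theorem rstep_ackFrom (ht : b + 2 * M + 1 ≤ t) (hu : u ≠ r)
    (h : Informed r l src lvl dom st B a c b t (ackFrom lvl b u β) S)
    (hn : NoAckStart r l src lvl B c b (t + 2)) {v : V} (hv : v ≠ r) :
    (rstep G l src S v).inf = (S v).inf ∧ (rstep G l src S v).sent = (S v).sent ∧
    (rstep G l src S v).heard ≠ some .stay ∧
    (v ≠ par u → ∀ τ β', (rstep G l src S v).heard = some (.ack τ β') → τ ∉ (S v).sent) ∧
    (rstep G l src S v).action (l v) (src v) = ackFrom lvl b (par u) β v := by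
  have htx : (fun w => (S w).action (l w) (src w)) = ackFrom lvl b u β := funext h.action
  obtain ⟨h1, -, h2⟩ := hS.rstep_ackFrom_of_ne h (v := v) (fun h' => absurd h' hv)
  have hhd : (rstep G l src S v).heard = hear G (ackFrom lvl b u β) v := by
    rw [rstep, NodeState.heard_receive, htx]
  rw [hear_ackFrom] at hhd
  have hstay : (rstep G l src S v).heard ≠ some .stay := by
    rw [hhd]; split_ifs <;> simp
  have hack : v ≠ par u → ∀ τ β', (rstep G l src S v).heard = some (.ack τ β') →
      τ ∉ (S v).sent := by
    intro hne τ β' hh hmem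
    rw [hhd] at hh
    split_ifs at hh with h'
    simp only [Option.some.injEq, Msg.ack.injEq] at hh
    rw [← hh.1] at hmem
    exact hne ((hS.mem_sent_iff h hu h').mp hmem)
  refine ⟨h1, h2, hstay, hack, ?_⟩
  obtain ⟨h3, h4, h5⟩ := h.sync.rstep (G := G) (l := l) (src := src) v
  obtain ⟨-, h6, h7⟩ := hS.action_eq_of_informed (src := src) hst h3 h4 h5 (by omega)
    (h1.trans (h.inf v)) hstay hn
  rw [ackFrom]
  split_ifs with hp
  · subst hp
    have hadj := (hS.adj_par u hu).symm
    rw [h7 hv (b + (2 * lvl u - 1)) β]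
    · rw [hhd, if_pos hadj]
    · rw [h2, hS.mem_sent_iff h hu hadj]
  · refine h6 hv ?_
    rw [h2]
    exact hack hp

include hst in
theorem informed_ack (ht : b + 2 * M + 1 ≤ t) (hu : u ≠ r) (hp : par u ≠ r)
    (h : Informed r l src lvl dom st B a c b t (ackFrom lvl b u β) S)
    (hn : NoAckStart r l src lvl B c b (t + 2)) :
    Informed r l src lvl dom st B a c b (t + 1) (ackFrom lvl b (par u) β) (rstep G l src S) := by
  have hr := hS.rstep_ackFrom_of_ne h (v := r) (fun _ h' =>
    hp ((hS.mem_sent_iff h hu h'.1).mp h'.2).symm)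
  have hv : ∀ v, (rstep G l src S v).inf = (S v).inf ∧ (rstep G l src S v).sent = (S v).sent := by
    intro v
    by_cases hvr : v = r
    · rw [hvr]; exact ⟨hr.1, hr.2.2⟩
    · have := hS.rstep_ackFrom hst ht hu h hn hvr
      exact ⟨this.1, this.2.1⟩
  refine ⟨h.sync.rstep, ?_, fun v => ?_, fun v τ => ?_, fun v => ?_⟩
  · rw [hr.2.1, h.acked]
  · rw [(hv v).1, h.inf]
  · rw [(hv v).2, h.sent]
  · by_cases hvr : v = r
    · subst hvr
      obtain ⟨h3, h4, h5⟩ := h.sync.rstep (G := G) (l := l) (src := src) v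
      have htx : (fun w => (S w).action (l w) (src w)) = ackFrom lvl b u β := funext h.action
      have hhd : (rstep G l src S v).heard = hear G (ackFrom lvl b u β) v := by
        rw [rstep, NodeState.heard_receive, htx]
      rw [hear_ackFrom] at hhd
      rw [(hS.action_eq_of_informed (src := src) hst h3 h4 h5 (by omega)
        ((hv v).1.trans (h.inf v)) (by rw [hhd]; split_ifs <;> simp) hn).1 rfl, ackFrom,
        if_neg hp.symm]
    · exact (hS.rstep_ackFrom hst ht hu h hn hvr).2.2.2.2

theorem hear_ackFrom_coordinator (hu : u ≠ r) (hp : par u = r)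
    (h : Informed r l src lvl dom st B a c b t (ackFrom lvl b u β) S) :
    hear G (fun w => (S w).action (l w) (src w)) r = some (.ack (b + (2 * lvl u - 1)) β) ∧
    b + (2 * lvl u - 1) ∈ (S r).sent := by
  have htx : (fun w => (S w).action (l w) (src w)) = ackFrom lvl b u β := funext h.action
  have hadj := (hS.adj_par u hu).symm
  rw [hp] at hadj
  rw [htx, hear_ackFrom, if_pos hadj, hS.mem_sent_iff h hu hadj]
  exact ⟨rfl, hp.symm⟩

include hst in
/-- The coordinator receives an acknowledgement that does not cause it to broadcast again. -/
theorem informed_ack_coordinator (ht : b + 2 * M + 1 ≤ t) (hu : u ≠ r) (hp : par u = r)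
    (hβ : ∀ m, β ≠ .round m)
    (h : Informed r l src lvl dom st B a c b t (ackFrom lvl b u β) S)
    (hn : NoAckStart r l src lvl B c b (t + 2)) :
    Informed r l src lvl dom st B true c b (t + 1) (fun _ => none) (rstep G l src S) ∧
    Msg.contents (.ack 0 β) ⊆ (rstep G l src S r).known := by
  obtain ⟨h1, h2⟩ := hS.hear_ackFrom_coordinator hu hp h
  obtain ⟨h3, h4, h5⟩ := NodeState.receive_of_ack (src := src r) hS.coord_eq_true h2 hβ
  have hx : rstep G l src S r = (S r).receive (l r) (src r)
      (some (.ack (b + (2 * lvl u - 1)) β)) := by rw [rstep, h1]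
  rw [← hx] at h3 h4 h5
  have h6 : (rstep G l src S r).sent = (S r).sent := by
    rw [h5, h.action, ackFrom, if_neg hu.symm]
  have hv : ∀ v, (rstep G l src S v).inf = (S v).inf ∧ (rstep G l src S v).sent = (S v).sent := by
    intro v
    by_cases hvr : v = r
    · rw [hvr]; exact ⟨h3, h6⟩
    · have := hS.rstep_ackFrom hst ht hu h hn hvr
      exact ⟨this.1, this.2.1⟩
  refine ⟨⟨h.sync.rstep, h4, fun v => ?_, fun v τ => ?_, fun v => ?_⟩, ?_⟩
  · rw [(hv v).1, h.inf]
  · rw [(hv v).2, h.sent]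
  · by_cases hvr : v = r
    · subst hvr
      obtain ⟨h7, h8, h9⟩ := h.sync.rstep (G := G) (l := l) (src := src) v
      exact (hS.action_eq_of_informed (src := src) hst h7 h8 h9 (by omega)
        (h3.trans (h.inf v)) (by rw [hx, NodeState.heard_receive]; simp) hn).1 rfl
    · rw [(hS.rstep_ackFrom hst ht hu h hn hvr).2.2.2.2, ackFrom, if_neg (by rwa [hp])]
  · rw [hx, NodeState.known_receive]
    cases β <;> simp [Msg.contents]

include hst in
/-- The coordinator receives the acknowledgement of "init", and goes on with the next broadcast. -/
theorem beforeData_ack_coordinator {m : ℕ} (ht : b + 2 * M + 1 ≤ t) (hu : u ≠ r) (hp : par u = r)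
    (h : Informed r l src lvl dom st B a .init b t (ackFrom lvl b u (.round m)) S)
    (hn : NoAckStart r l src lvl B .init b (t + 2)) :
    BeforeData r l lvl dom st B true (.bound m) (t + 1) 0 (rstep G l src S) := by
  obtain ⟨h1, h2⟩ := hS.hear_ackFrom_coordinator hu hp h
  obtain ⟨h3, h4, h5⟩ := NodeState.receive_of_ack_round (src := src r) (m := m)
    hS.coord_eq_true h2
  have hx : rstep G l src S r = (S r).receive (l r) (src r)
      (some (.ack (b + (2 * lvl u - 1)) (.round m))) := by rw [rstep, h1]
  rw [← hx] at h3 h4 h5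
  refine ⟨h.sync.rstep, h5, fun v hv => ?_, fun v hv => ?_, fun v hv τ => ?_, fun i' hi' => ?_,
    fun v hv hvr => ?_⟩
  · have hvr := hS.ne_of_lvl hv
    obtain ⟨h6, h7, h8, h9, -⟩ := hS.rstep_ackFrom hst ht hu h hn hvr
    have hsync := (h.sync.rstep (G := G) (l := l) (src := src) v).2.2
    have hM := hS.lvl_le v
    have hsent : ∀ τ ∈ (S v).sent, τ + 1 ≤ t + 1 := by
      intro τ hτ
      obtain ⟨i, hi, rfl⟩ := (h.sent v τ).mp hτ
      have := hS.lt_of_dom hi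
      omega
    -- The node still holds "init". Its transmissions took place in rounds up to `b + 2 M + 1 ≤ t`,
    -- so they count as stale in the sense of `Quiet`.
    right
    refine ⟨by simp, b + (2 * lvl v - 1), h6.trans (h.inf v), by omega, fun hj => ?_, ?_, ?_, ?_⟩
    · rw [hS.join_iff (lvl v - 1) v (by omega)] at hj
      have := hS.lt_of_dom hj
      omega
    · rw [h7, hsync]; exact hsent
    · exact fun h' => absurd h' h8
    · rw [h7]; exact h9 (by rwa [hp])
  · have hvr := (hS.lvl_eq_zero v).mp (by omega)
    rw [hvr, h3, (h.sync r).2.2, hS.lvl_r]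
  · have hvr := (hS.lvl_eq_zero v).mp (by omega)
    rw [hvr, h4]
    simp
  · omega
  · exact absurd ((hS.lvl_eq_zero v).mp (by omega)) hvr

include hst in
/-- An acknowledgement is forwarded to a neighbour of the coordinator. -/
theorem ack_chain (ht : b + 2 * M + 1 ≤ t) (hu : u ≠ r)
    (h : Informed r l src lvl dom st B a c b t (ackFrom lvl b u β) S)
    (hn : ∀ t' ≥ t + 2, NoAckStart r l src lvl B c b t') :
    ∃ q < lvl u, (∀ j ≤ q, ∃ tx,
        Informed r l src lvl dom st B a c b (t + j) tx ((rstep G l src)^[j] S)) ∧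
      ∃ u' ≠ r, par u' = r ∧
        Informed r l src lvl dom st B a c b (t + q) (ackFrom lvl b u' β) ((rstep G l src)^[q] S) := by
  induction hk : lvl u using Nat.strong_induction_on generalizing u t S with
  | _ k ih =>
    subst hk
    by_cases hp : par u = r
    · refine ⟨0, hS.lvl_pos hu, fun j hj => ?_, u, hu, hp, h⟩
      rw [Nat.le_zero.mp hj]
      exact ⟨_, h⟩
    · have h1 := hS.informed_ack hst ht hu hp h (hn _ le_rfl)
      obtain ⟨q, hq, h2, u', hu', hp', h3⟩ := ih (lvl (par u)) (hS.lvl_par_lt hu) (by omega) hp h1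
        (fun t' h' => hn t' (by omega)) rfl
      have hlt := hS.lvl_par_lt hu
      refine ⟨q + 1, by omega, fun j hj => ?_, u', hu', hp', ?_⟩
      · cases j with
        | zero => exact ⟨_, h⟩
        | succ j =>
          obtain ⟨tx, h4⟩ := h2 j (by omega)
          rw [Function.iterate_succ_apply]
          exact ⟨tx, by rwa [add_assoc, add_comm 1 j] at h4⟩
      · rw [Function.iterate_succ_apply]
        rwa [add_assoc, add_comm 1 q] at h3

end Schedule

end Acknowledgement

/-! ### Source messages known to the nodes -/

namespace NodeState

variable {l : Label} {src : Option Bits} {S : NodeState} {h : Option Msg}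

theorem inf_receive {K : Finset Bits} {e : ℕ}
    (hi : (S.receive l src h).inf = some (.inform K, e)) :
    S.inf = some (.inform K, e) ∨ ∃ τ, h = some (.data (.inform K) τ) := by
  rcases h with _ | ⟨c, τ⟩ | _ | ⟨τ, β⟩ | K'
  · exact .inl hi
  · simp only [receive] at hi
    split_ifs at hi
    · simp only [Option.some.injEq, Prod.mk.injEq] at hi
      exact .inr ⟨τ, by rw [hi.1]⟩
    · exact .inl hi
  · exact .inl hi
  · simp only [receive] at hi
    split_ifs at hi
    · cases β
      · exact .inl hi
      · simp at hi
      · exact .inl hi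
    · exact .inl hi
  · exact .inl hi

theorem inf_begin {st : Stage} {ph : ℕ} {c : Content} {K : Finset Bits} {e : ℕ}
    (hi : (S.begin l st ph c).inf = some (.inform K, e)) : c = .inform K := by
  simp only [begin] at hi
  split_ifs at hi
  simp only [Option.some.injEq, Prod.mk.injEq] at hi
  exact hi.1

/-- What the invariant `KnownIn` needs about a change of subroutine: a set that is newly put up for
broadcast is the one possessed at that moment. -/
theorem advance_cases {X : NodeState} (hX : S.advance l = X) :
    (X.inf = S.inf ∧ X.heard = S.heard) ∨
    (X.heard = none ∧ ∀ K e, X.inf = some (.inform K, e) → K = S.known) := by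
  unfold advance at hX
  repeat' split at hX
  all_goals subst hX
  all_goals first
    | exact .inl ⟨rfl, rfl⟩
    | exact .inr ⟨rfl, fun K e h => by simpa using (inf_begin h).symm⟩
    | exact .inr ⟨rfl, fun K e h => by simpa using inf_begin (S := S) (l := l) (st := .individualCollect) (ph := 1) h⟩
    | exact .inr ⟨rfl, fun K e h => by simp at h⟩

theorem inf_advance {K : Finset Bits} {e : ℕ} (hi : (S.advance l).inf = some (.inform K, e)) :
    S.inf = some (.inform K, e) ∨ K = S.known := by
  rcases advance_cases (S := S) (l := l) rfl with h | h
  · exact .inl (h.1 ▸ hi)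
  · exact .inr (h.2 K e hi)

theorem heard_advance {m : Msg} (hi : (S.advance l).heard = some m) : S.heard = some m := by
  rcases advance_cases (S := S) (l := l) rfl with h | h
  · exact h.2 ▸ hi
  · simp [h.1] at hi

/-- The node only has messages from `A`, and possesses what it broadcasts. -/
structure KnownIn (A : Finset Bits) (S : NodeState) : Prop where
  known : S.known ⊆ A
  inf : ∀ K e, S.inf = some (.inform K, e) → K ⊆ S.known
  heard : ∀ τ x, S.heard = some (.ack τ (.sourceMsg x)) → x ∈ A

theorem startsAck_eq {c : Content} {e t : ℕ} {x : Bits}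
    (h : startsAck l src S c e t = some (.sourceMsg x)) : src = some x := by
  unfold startsAck at h
  split at h
  · split_ifs at h; simp at h
  · split_ifs at h; simp at h
  · split_ifs at h; simp at h
  · split_ifs at h; simpa using h
  · simp at h

theorem broadcastAction_cases {c : Content} {e t : ℕ} {m : Msg}
    (h : broadcastAction l src S c e t = some m) :
    m = .data c t ∨ m = .stay ∨ (∃ τ β, S.heard = some (.ack τ β) ∧ m = .ack e β) ∨
      ∃ β, startsAck l src S c e t = some β ∧ m = .ack e β := by
  unfold broadcastAction at h
  by_cases h1 : l.isCoordinator = true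
  · rw [if_pos h1] at h
    split_ifs at h <;> exact .inl (Option.some_inj.mp h).symm
  rw [if_neg h1] at h
  by_cases h2 : l.stay = true ∧ t = e + 1
  · rw [if_pos h2] at h
    exact .inr (.inl (Option.some_inj.mp h).symm)
  rw [if_neg h2] at h
  by_cases h3 : l.join = true ∧ t = e + 2
  · rw [if_pos h3] at h
    exact .inl (Option.some_inj.mp h).symm
  rw [if_neg h3] at h
  split at h
  · split_ifs at h
    exact .inl (Option.some_inj.mp h).symm
  · rename_i τ β hh
    split_ifs at h
    exact .inr (.inr (.inl ⟨τ, β, hh, (Option.some_inj.mp h).symm⟩))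
  · obtain ⟨β, h4, h5⟩ := Option.map_eq_some_iff.mp h
    exact .inr (.inr (.inr ⟨β, h4, h5.symm⟩))

variable {A : Finset Bits}

theorem KnownIn.contents_subset (hS : S.KnownIn A) (hsrc : ∀ x, src = some x → x ∈ A) {m : Msg}
    (hm : S.action l src = some m) : m.contents ⊆ A := by
  have key : S.inf.bind (fun p => broadcastAction l src S p.1 p.2 (S.clock + 1)) = some m →
      m.contents ⊆ A := by
    intro h
    obtain ⟨⟨c, e⟩, hi, hp⟩ := Option.bind_eq_some_iff.mp h
    rcases broadcastAction_cases hp with rfl | rfl | ⟨τ, β, hh, rfl⟩ | ⟨β, hh, rfl⟩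
    · cases c with
      | inform K => exact (hS.inf K e hi).trans hS.known
      | _ => simp [Msg.contents]
    · simp [Msg.contents]
    · cases β with
      | sourceMsg x => simpa [Msg.contents] using hS.heard τ x hh
      | _ => simp [Msg.contents]
    · cases β with
      | sourceMsg x => simpa [Msg.contents] using hsrc x (startsAck_eq hh)
      | _ => simp [Msg.contents]
  unfold action at hm
  split at hm
  · simp at hm
  · split_ifs at hm
    rw [← Option.some_inj.mp hm]
    exact hS.known
  · exact key hm

theorem KnownIn.receive (hS : S.KnownIn A) (hh : ∀ m, h = some m → m.contents ⊆ A) :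
    (S.receive l src h).KnownIn A := by
  refine ⟨?_, fun K e hi => ?_, fun τ x hi => ?_⟩
  · rw [known_receive]
    refine Finset.union_subset hS.known ?_
    cases h with
    | none => simp
    | some m => simpa using hh m rfl
  · rw [known_receive]
    rcases inf_receive hi with h1 | ⟨τ, rfl⟩
    · exact (hS.inf K e h1).trans Finset.subset_union_left
    · exact Finset.subset_union_right (s₂ := K)
  · rw [heard_receive] at hi
    simpa [Msg.contents] using hh _ hi

theorem KnownIn.advance (hS : S.KnownIn A) : (S.advance l).KnownIn A := by
  refine ⟨by simpa using hS.known, fun K e hi => ?_, fun τ x hi => hS.heard τ x (heard_advance hi)⟩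
  rw [known_advance]
  rcases inf_advance hi with h1 | rfl
  · exact hS.inf K e h1
  · exact subset_rfl

theorem KnownIn.start (hsrc : ∀ x, src = some x → x ∈ A) : (start l src).KnownIn A := by
  refine ⟨fun x hx => hsrc x (by simpa [NodeState.start] using hx), fun K e hi => ?_, fun τ x hi => ?_⟩
  · simp only [NodeState.start] at hi
    split_ifs at hi
    simp at hi
  · simp [NodeState.start] at hi

end NodeState

section

variable {V : Type*} {G : SimpleGraph V} {l : V → Label} {src : V → Option Bits}

/-- Soundness: every transmitted source message was possessed, heard or held initially by its
sender, so nothing outside `A` can arise. -/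
theorem knownIn_run {A : Finset Bits} (hsrc : ∀ v x, src v = some x → x ∈ A) (j : ℕ) (v : V) :
    (run G l src j v).KnownIn A := by
  induction j generalizing v with
  | zero => exact NodeState.KnownIn.start (hsrc v)
  | succ j ih =>
    rw [run_succ]
    refine ((ih v).receive fun m hm => ?_).advance
    obtain ⟨-, w, -, hw, -⟩ := exists_of_hear_eq_some hm
    exact (ih w).contents_subset (hsrc w) hw

theorem known_subset_rstep (S : V → NodeState) (v : V) :
    (S v).known ⊆ (rstep G l src S v).known := by
  rw [rstep, NodeState.known_receive]
  exact Finset.subset_union_left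

theorem known_subset_iterate (S : V → NodeState) (v : V) {i j : ℕ} (h : i ≤ j) :
    ((rstep G l src)^[i] S v).known ⊆ ((rstep G l src)^[j] S v).known := by
  induction j, h using Nat.le_induction with
  | base => exact subset_rfl
  | succ j _ ih =>
    rw [Function.iterate_succ_apply']
    exact ih.trans (known_subset_rstep _ v)

theorem known_subset_run (v : V) {i j : ℕ} (h : i ≤ j) :
    (run G l src i v).known ⊆ (run G l src j v).known := by
  induction j, h using Nat.le_induction with
  | base => exact subset_rfl
  | succ j _ ih =>
    rw [run_succ, fstep, NodeState.known_advance]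
    exact ih.trans (known_subset_rstep _ v)

theorem mem_known_run {v : V} {x : Bits} (hx : src v = some x) (j : ℕ) :
    x ∈ (run G l src j v).known :=
  known_subset_run v (Nat.zero_le j) (by simp [run_zero, NodeState.start, hx])

end

/-! ### The subroutines -/

section Subroutines

variable {V : Type*} [DecidableEq V] {G : SimpleGraph V} {r : V} {l : V → Label} {lvl : V → ℕ}
  {dom : ℕ → Finset V} {par : V → V} {M : ℕ} {z : V} {src : V → Option Bits}

/-- The state of the network when the coordinator starts to broadcast `c` in a new subroutine or
phase. -/
structure PhaseStart (r : V) (st : Stage) (ph B : ℕ) (c : Content) (S : V → NodeState) : Prop where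
  stage : ∀ v, (S v).stage = st
  phase : ∀ v, (S v).phase = ph
  bound : ∀ v, (S v).bound = B
  clock : ∀ v, (S v).clock = 0
  inf : ∀ v, (S v).inf = if v = r then some (c, 0) else none
  sent : ∀ v, (S v).sent = ∅
  acked : (S r).acked = false
  heard : ∀ v, (S v).heard = none

theorem phase_iterate (S : V → NodeState) (j : ℕ) (v : V) :
    ((rstep G l src)^[j] S v).phase = (S v).phase := by
  induction j with
  | zero => rfl
  | succ j ih => rw [Function.iterate_succ_apply', rstep, NodeState.phase_receive, ih]

theorem sync_iterate {st : Stage} {B t : ℕ} {S : V → NodeState} (h : Sync st B t S) (j : ℕ) :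
    Sync st B (t + j) ((rstep G l src)^[j] S) := by
  induction j with
  | zero => exact h
  | succ j ih => rw [Function.iterate_succ_apply', ← add_assoc]; exact ih.rstep

theorem isBroadcast_init : Stage.IsBroadcast .initStage := ⟨by simp, by simp⟩
theorem isBroadcast_individual : Stage.IsBroadcast .individualCollect := ⟨by simp, by simp⟩
theorem isBroadcast_inform : Stage.IsBroadcast .informStage := ⟨by simp, by simp⟩

namespace NodeState

variable {l : Label} {S : NodeState}

theorem advance_init (hs : S.stage = .initStage)
    (h : ∀ m e, S.inf = some (.bound m, e) → S.clock ≠ 3 * m) : S.advance l = S := by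
  unfold advance
  rw [hs]
  dsimp only
  split
  · rw [if_neg (h _ _ ‹_›)]
  · rfl

theorem advance_inform (hs : S.stage = .informStage)
    (h : ∀ m e, S.inf ≠ some (.bound m, e)) : S.advance l = S := by
  unfold advance
  rw [hs]
  dsimp only
  split
  · exact absurd ‹_› (h _ _)
  · rfl

theorem advance_individual (hs : S.stage = .individualCollect) (h : S.clock ≠ 2 * S.bound) :
    S.advance l = S := by
  unfold advance
  rw [hs]
  dsimp only
  rw [if_neg h]

theorem advance_roundRobin (hs : S.stage = .roundRobinCollect)
    (h : S.clock ≠ S.bound * l.numColours) : S.advance l = S := by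
  unfold advance
  rw [hs]
  dsimp only
  rw [if_neg h]

theorem advance_init_end {m e : ℕ} (hs : S.stage = .initStage) (hi : S.inf = some (.bound m, e))
    (hc : S.clock = 3 * m) : S.advance l =
      if l.strat then { S.begin l .roundRobinCollect 0 .done with bound := m, inf := none }
      else { S.begin l .individualCollect 1 (.query 1) with bound := m } := by
  unfold advance
  rw [hs]
  dsimp only
  rw [hi]
  dsimp only
  rw [if_pos hc]

theorem advance_done_end {e : ℕ} (hs : S.stage = .individualCollect) (hi : S.inf = some (.done, e))
    (hc : S.clock = 2 * S.bound) :
    S.advance l = S.begin l .informStage 0 (.inform S.known) := by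
  unfold advance
  rw [hs]
  dsimp only
  rw [if_pos hc, hi]

theorem advance_query_end {i e : ℕ} (hs : S.stage = .individualCollect)
    (hi : S.inf = some (.query i, e)) (hc : S.clock = 2 * S.bound) :
    S.advance l = if S.acked = true ∨ l.sched = Nat.bits S.phase then
          S.begin l .individualCollect (S.phase + 1) (.query (S.phase + 1))
        else S.begin l .individualCollect (S.phase + 1) .done := by
  unfold advance
  rw [hs]
  dsimp only
  rw [if_pos hc, hi]

theorem advance_roundRobin_end (hs : S.stage = .roundRobinCollect)
    (hc : S.clock = S.bound * l.numColours) :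
    S.advance l = S.begin l .informStage 0 (.inform S.known) := by
  unfold advance
  rw [hs]
  dsimp only
  rw [if_pos hc]

end NodeState

namespace Schedule

variable (hS : Schedule G r l lvl dom par M z)
include hS

theorem beforeData_of_phaseStart {st : Stage} {ph B : ℕ} {c : Content} {S : V → NodeState}
    (h : PhaseStart r st ph B c S) : BeforeData r l lvl dom st B false c 0 0 S := by
  refine ⟨fun v => ⟨h.stage v, h.bound v, h.clock v⟩, h.acked, fun v hv => .inl ?_, fun v hv => ?_,
    fun v hv τ => ?_, fun i' hi' => ?_, fun v hv hvr => ?_⟩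
  · rw [h.inf, if_neg (hS.ne_of_lvl hv)]
  · have := (hS.lvl_eq_zero v).mp (by omega)
    rw [h.inf, if_pos this, this, hS.lvl_r]
  · simp [h.sent]
  · omega
  · simp [h.heard]

/-- In a bounded acknowledged broadcast, and at the end of the individual collection, only the
default acknowledger starts an acknowledgement. -/
theorem startsAck_default {c : Content} (hc : c = .init ∨ c = .done ∨ ∃ K, c = .inform K) {v : V}
    {b t : ℕ} (S : NodeState) (h : v ≠ z ∨ t ≠ b + 2 * M + 2) (hv : v ≠ r) :
    S.startsAck (l v) (src v) c (b + (2 * lvl v - 1)) t = none := by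
  have hpos := hS.lvl_pos hv
  have key : ¬ ((l v).isAcknowledger = true ∧ t = b + (2 * lvl v - 1) + 1) := by
    rintro ⟨h1, h2⟩
    rw [hS.acknowledger] at h1
    subst h1
    rw [hS.lvl_acknowledger] at h2
    rcases h with h | h
    · exact h rfl
    · omega
  rcases hc with rfl | rfl | ⟨K, rfl⟩ <;> exact if_neg key

theorem z_ne : z ≠ r := hS.ne_of_lvl (i := M) (by rw [hS.lvl_acknowledger]; omega)

theorem noAckStart_default {c : Content} (hc : c = .init ∨ c = .done ∨ ∃ K, c = .inform K)
    {B b t : ℕ} (h : t ≠ b + 2 * M + 2) : NoAckStart r l src lvl B c b t :=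
  fun _ hv S _ => hS.startsAck_default hc S (.inr h) hv

omit hS in
theorem noAckStart_bound {B b m t : ℕ} : NoAckStart r l src lvl B (.bound m) b t :=
  fun _ _ _ _ => rfl

variable {st : Stage} (hst : st.IsBroadcast) {B : ℕ} {a : Bool} {c : Content} {b : ℕ}
  {S : V → NodeState}
include hst

/-- Serves the broadcasts of `bound` and the queries that nobody answers by a message. -/
theorem silent_broadcast (h : BeforeData r l lvl dom st B a c b 0 S)
    (hn : ∀ t, NoAckStart r l src lvl B c b t) {J : ℕ} (hJ : 2 * M + 1 ≤ J) :
    Informed r l src lvl dom st B a c b (b + J) (fun _ => none) ((rstep G l src)^[J] S) := by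
  have h1 := hS.informed_of_afterData hst (hS.broadcast hst h (fun t _ => hn t) M le_rfl).2
    (fun _ => none) rfl (fun v hv S hB => hn _ v hv S hB)
  have h2 := hS.informed_idle_iterate hst le_rfl h1 (fun t _ => hn t) (J - (2 * M + 1))
  rw [← Function.iterate_add_apply] at h2
  convert h2 using 1
  · omega
  · congr 2; omega

/-- The state in which the single acknowledger `u` starts the acknowledgement. -/
theorem informed_acknowledger {β : AckBody} {u : V} (h : BeforeData r l lvl dom st B a c b 0 S)
    (hu : u ≠ r) (hn : ∀ t ≤ b + 2 * M + 1, NoAckStart r l src lvl B c b t)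
    (hy : ∀ v ≠ r, ∀ S : NodeState, S.bound = B →
      S.startsAck (l v) (src v) c (b + (2 * lvl v - 1)) (b + 2 * M + 2) =
        if v = u then some β else none) :
    Informed r l src lvl dom st B a c b (b + 2 * M + 1) (ackFrom lvl b u β)
      ((rstep G l src)^[2 * M + 1] S) := by
  have h1 := hS.informed_of_afterData hst (hS.broadcast hst h hn M le_rfl).2
    (fun v => if v = u then some β else none) (if_neg hu.symm) hy
  convert h1 using 1
  funext v
  rw [ackFrom]
  split_ifs with h
  · rw [h]; rfl
  · rfl

/-- The broadcast takes `2 M + 1` rounds and the acknowledgement at most `lvl u ≤ M + 1` more,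
whence `3 M + 2`. -/
theorem acked_broadcast {β : AckBody} {u : V} (h : BeforeData r l lvl dom st B a c b 0 S)
    (hu : u ≠ r) (hn : ∀ t ≠ b + 2 * M + 2, NoAckStart r l src lvl B c b t)
    (hy : ∀ v ≠ r, ∀ S : NodeState, S.bound = B →
      S.startsAck (l v) (src v) c (b + (2 * lvl v - 1)) (b + 2 * M + 2) =
        if v = u then some β else none)
    (hβ : ∀ m, β ≠ .round m) {J : ℕ} (hJ : 3 * M + 2 ≤ J) :
    Informed r l src lvl dom st B true c b (b + J) (fun _ => none) ((rstep G l src)^[J] S) ∧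
    Msg.contents (.ack 0 β) ⊆ ((rstep G l src)^[J] S r).known := by
  have h1 := hS.informed_acknowledger hst h hu (fun t _ => hn t (by omega)) hy
  obtain ⟨q, hq, -, u', hu', hp, h2⟩ := hS.ack_chain hst (by omega) hu h1
    (fun t' _ => hn t' (by omega))
  have hlt := hS.lvl_le u
  obtain ⟨h3, h4⟩ := hS.informed_ack_coordinator hst (by omega) hu' hp hβ h2 (hn _ (by omega))
  have h5 := hS.informed_idle_iterate hst (by omega) h3 (fun t' _ => hn t' (by omega))
    (J - (2 * M + 1 + q + 1))
  rw [← Function.iterate_succ_apply' (rstep G l src), ← Function.iterate_add_apply] at h4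
  rw [← Function.iterate_succ_apply' (rstep G l src), ← Function.iterate_add_apply,
    ← Function.iterate_add_apply] at h5
  refine ⟨?_, h4.trans (known_subset_iterate _ _ (by omega))⟩
  convert h5 using 1
  · omega
  · congr 2; omega

omit hst
theorem phaseStart_start : PhaseStart r .initStage 0 0 .init
    (fun v => NodeState.start (l v) (src v)) := by
  refine ⟨fun _ => rfl, fun _ => rfl, fun _ => rfl, fun _ => rfl, fun v => ?_, fun _ => rfl, rfl,
    fun _ => rfl⟩
  simp only [NodeState.start, hS.coord]

/-- The first subroutine ends in round `3 m` with `m = 2 M + 1`. -/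
theorem run_initStage (v : V) : ∃ (X : NodeState) (e : ℕ), run G l src (3 * (2 * M + 1)) v = X.advance (l v) ∧
    X.stage = .initStage ∧ X.clock = 3 * (2 * M + 1) ∧
    X.inf = some (.bound (2 * M + 1), e) := by
  have hst := isBroadcast_init
  set R : ℕ → V → NodeState := fun j => (rstep G l src)^[j] (run G l src 0) with hR
  have h0 : BeforeData r l lvl dom .initStage 0 false .init 0 0 (R 0) :=
    hS.beforeData_of_phaseStart hS.phaseStart_start
  have hz := hS.z_ne
  have hlz := hS.lvl_acknowledger
  have hn : ∀ t ≠ 0 + 2 * M + 2, NoAckStart r l src lvl 0 .init 0 t :=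
    fun t ht => hS.noAckStart_default (.inl rfl) ht
  have h1 : Informed r l src lvl dom .initStage 0 false .init 0 (0 + 2 * M + 1)
      (ackFrom lvl 0 z (.round (2 * M + 1))) (R (2 * M + 1)) := by
    refine hS.informed_acknowledger hst h0 hz (fun t ht => hn t (by omega)) fun v hv S _ => ?_
    split_ifs with hvz
    · subst hvz
      have : (l v).isAcknowledger = true ∧ 0 + 2 * M + 2 = 0 + (2 * lvl v - 1) + 1 :=
        ⟨(hS.acknowledger v).mpr rfl, by omega⟩
      rw [NodeState.startsAck, if_pos this, hlz]
      congr 2; omega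
    · exact hS.startsAck_default (.inl rfl) S (.inl hvz) hv
  obtain ⟨q, hq, hq', u, hu, hp, h2⟩ := hS.ack_chain hst (by omega) hz h1
    (fun t' _ => hn t' (by omega))
  have h3 := hS.beforeData_ack_coordinator hst (by omega) hu hp h2 (hn _ (by omega))
  have hadd : ∀ i j, (rstep G l src)^[i] (R j) = R (i + j) := fun i j => by
    simp only [hR, ← Function.iterate_add_apply]
  rw [hadd, ← Function.iterate_one (rstep G l src), hadd] at h3
  -- Nobody leaves early: during the first broadcast and its acknowledgement no `bound` is in
  -- circulation, and later every `bound` held is `2 M + 1`, while the clock shows `j < 3 * (2 * M +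
  -- 1)`.
  have hadv : ∀ j, 0 < j → j < 3 * (2 * M + 1) → ∀ v, (R j v).advance (l v) = R j v := by
    intro j hj0 hj v
    have hsync : Sync .initStage 0 j (R j) := by
      have := sync_iterate (G := G) (l := l) (src := src) h0.sync j
      rwa [hadd, mul_zero, add_zero, zero_add] at this
    refine NodeState.advance_init (hsync v).1 fun m e hi => ?_
    rw [(hsync v).2.2]
    rcases le_or_gt j (2 * M + 1) with hj1 | hj1
    · have h4 := (hS.inf_broadcast (src := src) hst h0 (fun t ht => hn t (by omega)) j hj1 v).2
      rw [hadd, add_zero] at h4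
      rcases h4 with h4 | ⟨e', h4 | h4⟩ <;> simp [h4] at hi
    rcases le_or_gt j (2 * M + 1 + q) with hj2 | hj2
    · obtain ⟨tx, h4⟩ := hq' (j - (2 * M + 1)) (by omega)
      rw [hadd, show j - (2 * M + 1) + (2 * M + 1) = j by omega] at h4
      simp [h4.inf v] at hi
    obtain ⟨j', rfl⟩ : ∃ j', j = j' + (1 + (q + (2 * M + 1))) :=
      ⟨j - (1 + (q + (2 * M + 1))), by omega⟩
    rcases le_or_gt j' (2 * M + 1) with hj3 | hj3
    · have h4 := (hS.inf_broadcast (src := src) hst h3 (fun t _ => noAckStart_bound) j' hj3 v).2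
      rw [hadd] at h4
      rcases h4 with h4 | ⟨e', h4 | h4⟩ <;> simp [h4] at hi
      omega
    · have h4 := (hS.silent_broadcast (src := src) hst h3 (fun _ => noAckStart_bound) hj3.le).inf v
      rw [hadd, hi] at h4
      simp at h4
      omega
  -- The second broadcast begins after `2 M + 2 + q` rounds with `q ≤ M` and lasts `2 M + 1`, so it
  -- is over by round `5 M + 3 ≤ 3 * (2 * M + 1)`.
  have hend := hS.silent_broadcast (src := src) hst h3 (fun _ => noAckStart_bound)
    (J := 3 * (2 * M + 1) - (1 + (q + (2 * M + 1)))) (by omega)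
  rw [hadd, show 3 * (2 * M + 1) - (1 + (q + (2 * M + 1))) + (1 + (q + (2 * M + 1))) =
    3 * (2 * M + 1) by omega] at hend
  refine ⟨R (3 * (2 * M + 1)) v, _, ?_, (hend.sync v).1, ?_, hend.inf v⟩
  · have := run_add_of_advance_end G l src (T := 0) (by omega) hadv v
    rwa [zero_add] at this
  · rw [(hend.sync v).2.2]
    omega

/-- The individual collection consists of phases that do not end early. -/
theorem run_individual {T ph m : ℕ} {c : Content} (hm : 0 < m)
    (h : PhaseStart r .individualCollect ph m c (run G l src T)) (v : V) :
    run G l src (T + 2 * m) v = ((rstep G l src)^[2 * m] (run G l src T) v).advance (l v) := by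
  refine run_add_of_advance_end G l src (by omega) (fun j _ hj v => ?_) v
  have hsync : Sync .individualCollect m (0 + j) ((rstep G l src)^[j] (run G l src T)) :=
    sync_iterate (fun v => ⟨h.stage v, h.bound v, h.clock v⟩) j
  refine NodeState.advance_individual (hsync v).1 ?_
  rw [(hsync v).2.2, (hsync v).2.1]
  omega

/-- `begin` stores the content only at the coordinator, so it does not matter that other nodes, with
their own `acked` flag and their own `known`, pass it a different one. -/
theorem phaseStart_begin {S S' : V → NodeState} {st : Stage} {ph B : ℕ} {c : Content}
    (hB : ∀ v, (S v).bound = B)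
    (h : ∀ v, ∃ c', S' v = (S v).begin (l v) st ph c' ∧ (v = r → c' = c)) :
    PhaseStart r st ph B c S' := by
  have key : ∀ v, S' v = (S v).begin (l v) st ph c := by
    intro v
    obtain ⟨c', h1, h2⟩ := h v
    rw [h1]
    by_cases hv : v = r
    · rw [h2 hv]
    · simp [NodeState.begin, hS.coord_eq_false hv]
  refine ⟨fun v => ?_, fun v => ?_, fun v => ?_, fun v => ?_, fun v => ?_, fun v => ?_, ?_,
    fun v => ?_⟩ <;> simp only [key] <;> try rfl
  · exact hB v
  · simp only [NodeState.begin, hS.coord]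

/-- The end of a phase in which the coordinator broadcast a number. -/
theorem phaseStart_of_query {T i : ℕ} {a : Bool}
    (h : PhaseStart r .individualCollect i (2 * M + 1) (.query i) (run G l src T))
    (hI : Informed r l src lvl dom .individualCollect (2 * M + 1) a (.query i) 0
      (0 + 2 * (2 * M + 1)) (fun _ => none) ((rstep G l src)^[2 * (2 * M + 1)] (run G l src T))) :
    PhaseStart r .individualCollect (i + 1) (2 * M + 1)
      (if a = true ∨ (l r).sched = Nat.bits i then .query (i + 1) else .done)
      (run G l src (T + 2 * (2 * M + 1))) := by
  refine hS.phaseStart_begin (fun v => (hI.sync v).2.1) fun v => ?_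
  have hph := (phase_iterate (G := G) (l := l) (src := src) (run G l src T)
    (2 * (2 * M + 1)) v).trans (h.phase v)
  rw [hS.run_individual (by omega) h, NodeState.advance_query_end (hI.sync v).1 (hI.inf v)
    (by rw [(hI.sync v).2.2, (hI.sync v).2.1]; omega), hph]
  by_cases hv : v = r
  · rw [hv, hI.acked]
    exact ⟨_, (apply_ite _ _ _ _).symm, fun _ => rfl⟩
  · split_ifs
    · exact ⟨_, rfl, fun h => absurd h hv⟩
    · exact ⟨_, rfl, fun h => absurd h hv⟩
    · exact ⟨_, rfl, fun h => absurd h hv⟩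
    · exact ⟨_, rfl, fun h => absurd h hv⟩

theorem startsAck_query {i : ℕ} {v : V} {e t : ℕ} {S : NodeState} (hv : v ≠ r) :
    S.startsAck (l v) (src v) (.query i) e t =
      if (l v).sched = Nat.bits i ∧ t = S.bound + 1 then (src v).map .sourceMsg else none := by
  simp [NodeState.startsAck, hS.coord_eq_false hv]

/-- A phase in which a source other than the coordinator is queried. -/
theorem run_query {T i : ℕ} {u : V} {x : Bits}
    (h : PhaseStart r .individualCollect i (2 * M + 1) (.query i) (run G l src T))
    (hu : u ≠ r) (hx : src u = some x) (hi : ∀ v, (l v).sched = Nat.bits i ↔ v = u) :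
    PhaseStart r .individualCollect (i + 1) (2 * M + 1) (.query (i + 1))
      (run G l src (T + 2 * (2 * M + 1))) ∧ x ∈ (run G l src (T + 2 * (2 * M + 1)) r).known := by
  have h1 := hS.acked_broadcast (β := .sourceMsg x) (u := u) (src := src) isBroadcast_individual
    (hS.beforeData_of_phaseStart h) hu (fun t ht v hv S hB => ?_) (fun v hv S hB => ?_) (by simp)
    (J := 2 * (2 * M + 1)) (by omega)
  · refine ⟨?_, ?_⟩
    · have h2 := hS.phaseStart_of_query h h1.1
      rwa [if_pos (.inl rfl)] at h2
    · rw [hS.run_individual (by omega) h, NodeState.known_advance]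
      exact h1.2 (by simp [Msg.contents])
  -- The queried node waits for round `m + 1 = 2 M + 2`, by which the query has reached everybody;
  -- its answer does not disturb the broadcast.
  · rw [hS.startsAck_query hv, if_neg]
    rintro ⟨-, h2⟩
    omega
  · rw [hS.startsAck_query hv]
    simp only [hi]
    by_cases hvu : v = u
    · rw [if_pos ⟨hvu, by omega⟩, if_pos hvu, hvu, hx]; rfl
    · rw [if_neg fun h => hvu h.1, if_neg hvu]

/-- A phase in which no node other than the coordinator is queried. -/
theorem run_query_silent {T i : ℕ}
    (h : PhaseStart r .individualCollect i (2 * M + 1) (.query i) (run G l src T))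
    (hi : ∀ v ≠ r, (l v).sched ≠ Nat.bits i) :
    PhaseStart r .individualCollect (i + 1) (2 * M + 1)
      (if (l r).sched = Nat.bits i then .query (i + 1) else .done)
      (run G l src (T + 2 * (2 * M + 1))) := by
  have h1 := hS.silent_broadcast (src := src) isBroadcast_individual
    (hS.beforeData_of_phaseStart h) (fun t v hv S hB => ?_) (J := 2 * (2 * M + 1)) (by omega)
  · simpa using hS.phaseStart_of_query h h1
  · rw [hS.startsAck_query hv, if_neg fun h => hi v hv h.1]

/-- The last phase of the individual collection. -/
theorem run_done {T i : ℕ}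
    (h : PhaseStart r .individualCollect i (2 * M + 1) .done (run G l src T)) :
    PhaseStart r .informStage 0 (2 * M + 1) (.inform (run G l src (T + 2 * (2 * M + 1)) r).known)
      (run G l src (T + 2 * (2 * M + 1))) := by
  have h1 := (hS.acked_broadcast (β := .plain) (u := z) (src := src) isBroadcast_individual
    (hS.beforeData_of_phaseStart h) hS.z_ne
    (fun t ht => hS.noAckStart_default (.inr (.inl rfl)) ht)
    (fun v hv S hB => ?_) (by simp) (J := 2 * (2 * M + 1)) (by omega)).1
  · refine hS.phaseStart_begin (fun v => (h1.sync v).2.1) fun v => ?_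
    refine ⟨.inform ((rstep G l src)^[2 * (2 * M + 1)] (run G l src T) v).known, ?_, fun hv => ?_⟩
    · rw [hS.run_individual (by omega) h v, NodeState.advance_done_end (h1.sync v).1 (h1.inf v)
        (by rw [(h1.sync v).2.2, (h1.sync v).2.1]; omega)]
    · rw [hv, hS.run_individual (by omega) h, NodeState.known_advance]
  · split_ifs with hvz
    · subst hvz
      have hlz := hS.lvl_acknowledger
      exact if_pos ⟨(hS.acknowledger v).mpr rfl, by omega⟩
    · exact hS.startsAck_default (.inr (.inl rfl)) S (.inl hvz) hv

/-- The last subroutine informs all nodes. -/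
theorem run_inform {T : ℕ} {K : Finset Bits}
    (h : PhaseStart r .informStage 0 (2 * M + 1) (.inform K) (run G l src T)) (v : V) :
    ∃ e, (run G l src (T + (2 * M + 1)) v).inf = some (.inform K, e) := by
  have hst := isBroadcast_inform
  have h0 := hS.beforeData_of_phaseStart h
  have hn : ∀ t ≤ 0 + 2 * M + 1, NoAckStart r l src lvl (2 * M + 1) (.inform K) 0 t :=
    fun t ht => hS.noAckStart_default (.inr (.inr ⟨K, rfl⟩)) (by omega)
  -- This subroutine can end only at a node that holds a `bound`, and none does in the first `2 M +
  -- 1` rounds. `J` is one larger because the bound on `j` is strict.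
  have hrun := run_add_of_advance G l src (T := T) (J := 2 * M + 2) (fun j _ hj v => by
    have h1 := hS.inf_broadcast (src := src) hst h0 hn j (by omega) v
    refine NodeState.advance_inform (h1.1 v).1 fun m e hi => ?_
    rcases h1.2 with h4 | ⟨e', h4 | h4⟩ <;> simp [h4] at hi) (2 * M + 1) (by omega)
  rw [hrun]
  exact ⟨_, (hS.broadcast hst h0 hn M le_rfl).2.inf v (hS.lvl_le v)⟩

end Schedule

end Subroutines

/-! ### Binary representations -/

theorem length_binary (L a : ℕ) : (binary L a).length = L := by simp [binary]

theorem binary_inj {L a b : ℕ} (ha : a < 2 ^ L) (hb : b < 2 ^ L) (h : binary L a = binary L b) :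
    a = b := by
  refine Nat.eq_of_testBit_eq fun j => ?_
  rcases lt_or_ge j L with hj | hj
  · have := congrArg (fun x => x[j]?) h
    simpa [binary, hj] using this
  · have hp : 2 ^ L ≤ 2 ^ j := Nat.pow_le_pow_right (by norm_num) hj
    rw [Nat.testBit_lt_two_pow (ha.trans_le hp), Nat.testBit_lt_two_pow (hb.trans_le hp)]

theorem bits_injective : Function.Injective Nat.bits := by
  intro a b h
  refine Nat.eq_of_testBit_eq fun j => ?_
  rw [Nat.testBit_eq_inth, Nat.testBit_eq_inth, h]

/-- Binary representations have no leading zero, and that of `0` is empty. Hence the default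
`[false]` of the non-sources matches no query. -/
theorem bits_ne_false (i : ℕ) : Nat.bits i ≠ [false] := by
  intro h
  have h1 : ∀ j, Nat.testBit i j = false := by
    intro j
    rw [Nat.testBit_eq_inth, h]
    cases j <;> rfl
  have h2 : i = 0 := Nat.eq_of_testBit_eq fun j => by simp [h1]
  simp [h2] at h

/-! ### The two ways of collecting the source messages -/

section Subroutines

variable {V : Type*} [DecidableEq V] {G : SimpleGraph V} {r : V} {l : V → Label} {lvl : V → ℕ}
  {dom : ℕ → Finset V} {par : V → V} {M : ℕ} {z : V} {src : V → Option Bits}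

namespace Schedule

variable (hS : Schedule G r l lvl dom par M z)
include hS

theorem phaseStart_individual (hstrat : ∀ v, (l v).strat = false) :
    PhaseStart r .individualCollect 1 (2 * M + 1) (.query 1) (run G l src (3 * (2 * M + 1))) := by
  have h := hS.run_initStage (src := src)
  have key : ∀ v, ∃ X : NodeState, run G l src (3 * (2 * M + 1)) v =
      { X.begin (l v) .individualCollect 1 (.query 1) with bound := 2 * M + 1 } := by
    intro v
    obtain ⟨X, e, h1, h2, h3, h4⟩ := h v
    refine ⟨X, ?_⟩
    rw [h1, NodeState.advance_init_end h2 h4 h3, hstrat v, if_neg (by simp)]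
  choose X hX using key
  refine ⟨fun v => ?_, fun v => ?_, fun v => ?_, fun v => ?_, fun v => ?_, fun v => ?_, ?_,
    fun v => ?_⟩ <;> simp only [hX, NodeState.begin, hS.coord]

/-- The individual collection brings all source messages to the coordinator. -/
theorem exists_phaseStart_inform_individual {k : ℕ} {s : Fin k → V}
    (hstrat : ∀ v, (l v).strat = false)
    (hsched : ∀ i : Fin k, (l (s i)).sched = Nat.bits ((i : ℕ) + 1))
    (hsched' : ∀ v, (∀ i, s i ≠ v) → (l v).sched = [false])
    {μ : Fin k → Bits} (hsrc : ∀ i, src (s i) = some (μ i)) :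
    ∃ T K, PhaseStart r .informStage 0 (2 * M + 1) (.inform K) (run G l src T) ∧ ∀ i, μ i ∈ K := by
  have hother : ∀ v i, (l v).sched = Nat.bits (i + 1) → ∃ j : Fin k, (j : ℕ) = i ∧ v = s j := by
    intro v i hv
    by_cases h : ∃ j, s j = v
    · obtain ⟨j, rfl⟩ := h
      rw [hsched] at hv
      have := bits_injective hv
      exact ⟨j, by omega, rfl⟩
    · rw [hsched' v (fun j hj => h ⟨j, hj⟩)] at hv
      exact absurd hv.symm (bits_ne_false _)
  have hphase : ∀ i ≤ k, ∃ T,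
      PhaseStart r .individualCollect (i + 1) (2 * M + 1) (.query (i + 1)) (run G l src T) ∧
      ∀ j : Fin k, (j : ℕ) < i → μ j ∈ (run G l src T r).known := by
    intro i
    induction i with
    | zero => exact fun _ => ⟨_, hS.phaseStart_individual hstrat, fun j hj => by omega⟩
    | succ i ih =>
      intro hi
      obtain ⟨T, hT, hK⟩ := ih (by omega)
      refine ⟨T + 2 * (2 * M + 1), ?_⟩
      have hmono : ∀ j : Fin k, (j : ℕ) < i →
          μ j ∈ (run G l src (T + 2 * (2 * M + 1)) r).known :=
        fun j hj => known_subset_run r (Nat.le_add_right _ _) (hK j hj)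
      set u := s ⟨i, hi⟩ with hu
      have hui : ∀ v, (l v).sched = Nat.bits (i + 1) ↔ v = u := by
        intro v
        constructor
        · intro hv
          obtain ⟨j, hj, rfl⟩ := hother v i hv
          rw [hu]
          congr 1
          exact Fin.ext hj
        · rintro rfl
          exact hsched _
      -- The coordinator does not answer itself by a message: the phase passes because its own
      -- `sched` matches, and its source message is known from the start.
      by_cases hur : u = r
      · have h1 := hS.run_query_silent hT fun v hv hv' => hv (((hui v).mp hv').trans hur)
        rw [if_pos ((hui r).mpr hur.symm)] at h1
        refine ⟨h1, fun j hj => ?_⟩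
        rcases (Nat.lt_succ_iff.mp hj).lt_or_eq with hj | hj
        · exact hmono j hj
        · refine mem_known_run ?_ _
          rw [← hur, hu, ← hsrc j]
          congr 2
          exact Fin.ext hj.symm
      · have h1 := hS.run_query hT hur (hsrc _) hui
        refine ⟨h1.1, fun j hj => ?_⟩
        rcases (Nat.lt_succ_iff.mp hj).lt_or_eq with hj | hj
        · exact hmono j hj
        · rw [show j = ⟨i, hi⟩ from Fin.ext hj]
          exact h1.2
  obtain ⟨T, hT, hK⟩ := hphase k le_rfl
  -- No label carries `k + 1`, so this query stays unanswered and "done" follows.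
  have hk : ∀ v, (l v).sched ≠ Nat.bits (k + 1) := by
    intro v hv
    obtain ⟨j, hj, -⟩ := hother v k hv
    omega
  have h1 := hS.run_query_silent hT fun v _ => hk v
  rw [if_neg (hk r)] at h1
  exact ⟨_, _, hS.run_done h1, fun i => known_subset_run r (by omega) (hK i i.2)⟩

/-! ### Collection in a round robin fashion -/

variable {L : ℕ} {col : V → ℕ}

theorem action_roundRobin {S : V → NodeState} {m j : ℕ} (h : Sync .roundRobinCollect m j S)
    (hsched : ∀ v, (l v).sched = binary L (col v)) (hL : 0 < L) (hcol : ∀ v, col v < 2 ^ L) (v : V) :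
    (S v).action (l v) (src v) =
      if col v = j % (2 ^ L - 1) + 1 then some (.known (S v).known) else none := by
  obtain ⟨h1, -, h3⟩ := h v
  have hlen : (l v).sched.length = L := by rw [hsched, length_binary]
  have hN : 0 < 2 ^ L - 1 := by
    have := Nat.pow_le_pow_right (n := 2) (by norm_num) hL
    omega
  have hlt := Nat.mod_lt j hN
  unfold NodeState.action
  rw [h1]
  dsimp only
  rw [Label.numColours, hlen, hsched, h3]
  refine if_congr ⟨fun h' => binary_inj (hcol v) (by omega) h', fun h' => by rw [h']⟩ rfl rfl

/-- In each phase of the round robin collection, each node learns what its neighbours knew. -/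
theorem known_subset_roundRobin {S : V → NodeState} {m : ℕ} (h : Sync .roundRobinCollect m 0 S)
    (hsched : ∀ v, (l v).sched = binary L (col v)) (hL : 0 < L) (hcol : ∀ v, col v < 2 ^ L)
    (hpos : ∀ v, 1 ≤ col v) (hsq : ∀ u v, (square G).Adj u v → col u ≠ col v) {u v : V}
    (huv : G.Adj v u) (p : ℕ) :
    ((rstep G l src)^[p * (2 ^ L - 1)] S u).known ⊆
      ((rstep G l src)^[(p + 1) * (2 ^ L - 1)] S v).known := by
  set N := 2 ^ L - 1 with hN
  have hu := hcol u
  have hu' := hpos u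
  -- The slot of `u` in phase `p`: colours are counted from `1`, elapsed rounds from `0`.
  set j := p * N + (col u - 1) with hj
  have hjN : j % N + 1 = col u := by
    rw [hj, mul_comm, Nat.mul_add_mod, Nat.mod_eq_of_lt (by omega)]
    omega
  have hsync : Sync .roundRobinCollect m (0 + j) ((rstep G l src)^[j] S) := sync_iterate h j
  rw [zero_add] at hsync
  have hact := action_roundRobin (src := src) hS hsync hsched hL hcol
  rw [← hN, hjN] at hact
  have hhear : hear G (fun w => ((rstep G l src)^[j] S w).action (l w) (src w)) v =
      some (.known ((rstep G l src)^[j] S u).known) := by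
    -- Colours differ at distance one, so `v` listens, and at distance two through `v`, so no other
    -- neighbour of `v` transmits.
    refine hear_eq_some ?_ huv ?_ fun w hw hs => ?_
    · simp only [hact]
      exact if_neg (hsq v u ⟨huv.ne, .inl huv⟩)
    · rw [hact, if_pos rfl]
    · by_contra hne
      simp only [hact] at hs
      rw [if_neg (hsq w u ⟨hne, .inr ⟨v, hw.symm, huv⟩⟩)] at hs
      simp at hs
  have h1 : ((rstep G l src)^[j] S u).known ⊆ ((rstep G l src)^[j + 1] S v).known := by
    rw [Function.iterate_succ_apply', rstep, hhear, NodeState.known_receive]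
    exact Finset.subset_union_right
  refine (known_subset_iterate S u (by omega)).trans (h1.trans (known_subset_iterate S v ?_))
  rw [add_mul, one_mul]
  omega

/-- Each phase carries knowledge from a node to its parent, whose level is strictly smaller. -/
theorem known_subset_coordinator {S : V → NodeState} {m : ℕ} (h : Sync .roundRobinCollect m 0 S)
    (hsched : ∀ v, (l v).sched = binary L (col v)) (hL : 0 < L) (hcol : ∀ v, col v < 2 ^ L)
    (hpos : ∀ v, 1 ≤ col v) (hsq : ∀ u v, (square G).Adj u v → col u ≠ col v) (q p : ℕ) (u : V)
    (hu : lvl u ≤ q) :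
    ((rstep G l src)^[p * (2 ^ L - 1)] S u).known ⊆
      ((rstep G l src)^[(p + q) * (2 ^ L - 1)] S r).known := by
  induction q generalizing p u with
  | zero =>
    rw [(hS.lvl_eq_zero u).mp (by omega)]
    rfl
  | succ q ih =>
    by_cases hur : u = r
    · rw [hur]
      exact known_subset_iterate S r (Nat.mul_le_mul_right _ (by omega))
    · have := hS.lvl_par_lt hur
      refine (hS.known_subset_roundRobin h hsched hL hcol hpos hsq
        (hS.adj_par u hur).symm p).trans ?_
      have h2 := ih (p + 1) (par u) (by omega)
      rwa [show p + 1 + q = p + (q + 1) by omega] at h2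

/-- The round robin collection brings all source messages to the coordinator. -/
theorem exists_phaseStart_inform_roundRobin (hstrat : ∀ v, (l v).strat = true)
    (hsched : ∀ v, (l v).sched = binary L (col v)) (hL : 0 < L) (hcol : ∀ v, col v < 2 ^ L)
    (hpos : ∀ v, 1 ≤ col v) (hsq : ∀ u v, (square G).Adj u v → col u ≠ col v) :
    ∃ T K, PhaseStart r .informStage 0 (2 * M + 1) (.inform K) (run G l src T) ∧
      ∀ v x, src v = some x → x ∈ K := by
  have hN : 0 < 2 ^ L - 1 := by
    have := Nat.pow_le_pow_right (n := 2) (by norm_num) hL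
    omega
  have hnum : ∀ v, (l v).numColours = 2 ^ L - 1 := by
    intro v
    rw [Label.numColours, hsched, length_binary]
  set T := 3 * (2 * M + 1) with hT
  have key : ∀ v, ∃ X : NodeState, run G l src T v =
      { X.begin (l v) .roundRobinCollect 0 .done with bound := 2 * M + 1, inf := none } := by
    intro v
    obtain ⟨X, e, h1, h2, h3, h4⟩ := hS.run_initStage (src := src) v
    refine ⟨X, ?_⟩
    rw [h1, NodeState.advance_init_end h2 h4 h3, hstrat v, if_pos rfl]
  choose X hX using key
  have hsync : Sync .roundRobinCollect (2 * M + 1) 0 (run G l src T) :=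
    fun v => by rw [hX]; exact ⟨rfl, rfl, rfl⟩
  have hit : ∀ j, Sync .roundRobinCollect (2 * M + 1) j ((rstep G l src)^[j] (run G l src T)) :=
    fun j => by simpa using sync_iterate (G := G) (l := l) (src := src) hsync j
  have hJ : 0 < (2 * M + 1) * (2 ^ L - 1) := Nat.mul_pos (by omega) hN
  have hend := run_add_of_advance_end G l src (T := T) hJ fun j _ hj v => by
    refine NodeState.advance_roundRobin (hit j v).1 ?_
    rw [(hit j v).2.2, (hit j v).2.1, hnum]
    omega
  refine ⟨T + (2 * M + 1) * (2 ^ L - 1),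
    (run G l src (T + (2 * M + 1) * (2 ^ L - 1)) r).known, ?_, fun v x hx => ?_⟩
  · refine hS.phaseStart_begin (fun v => (hit ((2 * M + 1) * (2 ^ L - 1)) v).2.1) fun v =>
      ⟨.inform ((rstep G l src)^[(2 * M + 1) * (2 ^ L - 1)] (run G l src T) v).known, ?_,
        fun hv => ?_⟩
    · rw [hend, NodeState.advance_roundRobin_end (hit _ v).1]
      rw [(hit _ v).2.2, (hit _ v).2.1, hnum]
    · rw [hv, hend, NodeState.known_advance]
  -- The `m = 2 M + 1` phases suffice because no level exceeds `M + 1`.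
  · have hlv := hS.lvl_le v
    have h1 := hS.known_subset_coordinator (src := src) hsync hsched hL hcol hpos hsq (2 * M + 1) 0 v
      (by omega)
    rw [zero_mul, zero_add] at h1
    rw [hend, NodeState.known_advance]
    exact h1 (mem_known_run hx T)

/-- After the last subroutine, all nodes possess what the coordinator collected. -/
theorem subset_known_of_phaseStart {T : ℕ} {K A : Finset Bits}
    (hsrc : ∀ v x, src v = some x → x ∈ A)
    (h : PhaseStart r .informStage 0 (2 * M + 1) (.inform K) (run G l src T)) (v : V) {j : ℕ}
    (hj : T + (2 * M + 1) ≤ j) : K ⊆ (run G l src j v).known := by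
  obtain ⟨e, he⟩ := hS.run_inform h v
  exact ((knownIn_run hsrc _ v).inf K e he).trans (known_subset_run v hj)

end Schedule

end Subroutines

/-! ### Greedy colourings -/

section Greedy

variable {V : Type*} [Fintype V] {H : SimpleGraph V} {order : V ≃ Fin (Fintype.card V)} {col : V → ℕ}

/-- The colouring is built along `order`: colouring the next node leaves the conditions at earlier
nodes untouched, as these refer only to their predecessors. -/
theorem exists_isGreedyColouring (H : SimpleGraph V) (order : V ≃ Fin (Fintype.card V)) :
    ∃ col, IsGreedyColouring H order col := by
  classical
  have hne : ∀ (v : V) (c : V → ℕ),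
      ∃ a, 1 ≤ a ∧ ∀ u, H.Adj u v → order u < order v → c u ≠ a := by
    intro v c
    refine ⟨Finset.univ.sup c + 1, by omega, fun u _ _ h => ?_⟩
    have := Finset.le_sup (f := c) (Finset.mem_univ u)
    omega
  have key : ∀ n : ℕ, ∃ col : V → ℕ, ∀ v, (order v : ℕ) < n →
      IsLeast {a : ℕ | 1 ≤ a ∧ ∀ u, H.Adj u v → order u < order v → col u ≠ a} (col v) := by
    intro n
    induction n with
    | zero => exact ⟨fun _ => 0, fun v hv => by omega⟩
    | succ n ih =>
      obtain ⟨col, hcol⟩ := ih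
      refine ⟨fun v => if (order v : ℕ) = n then Nat.find (hne v col) else col v, fun v hv => ?_⟩
      have hset : {a : ℕ | 1 ≤ a ∧ ∀ u, H.Adj u v → order u < order v →
          (if (order u : ℕ) = n then Nat.find (hne u col) else col u) ≠ a} =
          {a : ℕ | 1 ≤ a ∧ ∀ u, H.Adj u v → order u < order v → col u ≠ a} := by
        ext a
        simp only [Set.mem_ofPred_eq]
        refine and_congr_right fun _ => forall_congr' fun u => imp_congr_right fun _ =>
          forall_congr' fun hu => ?_
        have : (order u : ℕ) < order v := hu
        rw [if_neg (by omega)]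
      rw [hset]
      dsimp only
      by_cases hn : (order v : ℕ) = n
      · rw [if_pos hn]
        exact ⟨Nat.find_spec (hne v col), fun a ha => Nat.find_min' _ ha⟩
      · rw [if_neg hn]
        exact hcol v (by omega)
  obtain ⟨col, hcol⟩ := key (Fintype.card V)
  exact ⟨col, fun v => hcol v (order v).2⟩

namespace IsGreedyColouring

variable (h : IsGreedyColouring H order col)
include h

theorem pos (v : V) : 1 ≤ col v := (h v).1.1

theorem ne_of_adj {u v : V} (ha : H.Adj u v) : col u ≠ col v := by
  rcases lt_trichotomy (order u) (order v) with h1 | h1 | h1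
  · exact (h v).1.2 u ha h1
  · exact absurd (order.injective h1) ha.ne
  · exact ((h u).1.2 v ha.symm h1).symm

/-- The greedy choice skips a colour only if a neighbour has it. This yields both that the used
colours form an initial segment and the degree bound. -/
theorem exists_of_lt {v : V} {a : ℕ} (ha : 1 ≤ a) (hv : a < col v) :
    ∃ u, H.Adj u v ∧ col u = a := by
  by_contra! hcon
  have := (h v).2 (show a ∈ _ from ⟨ha, fun u hu _ => hcon u hu⟩)
  omega

/-- The colours that are used are `1, …, c`. -/
theorem le_card_image (v : V) : col v ≤ (Finset.univ.image col).card := by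
  have : Finset.Icc 1 (col v) ⊆ Finset.univ.image col := by
    intro a ha
    rw [Finset.mem_Icc] at ha
    rw [Finset.mem_image]
    rcases ha.2.lt_or_eq with h1 | h1
    · obtain ⟨u, -, hu⟩ := h.exists_of_lt ha.1 h1
      exact ⟨u, Finset.mem_univ _, hu⟩
    · exact ⟨v, Finset.mem_univ _, h1.symm⟩
  simpa using Finset.card_le_card this

theorem le_of_forall {d : ℕ} (hd : ∀ v, ∃ N : Finset V, N.card ≤ d ∧ ∀ u, H.Adj u v → u ∈ N)
    (v : V) : col v ≤ d + 1 := by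
  obtain ⟨N, hN, hN'⟩ := hd v
  have : Finset.Ico 1 (col v) ⊆ N.image col := by
    intro a ha
    rw [Finset.mem_Ico] at ha
    obtain ⟨u, hu, rfl⟩ := h.exists_of_lt ha.1 ha.2
    exact Finset.mem_image_of_mem _ (hN' u hu)
  have h1 := Finset.card_le_card this
  have h2 := Finset.card_image_le (s := N) (f := col)
  rw [Nat.card_Ico] at h1
  omega

theorem card_image_le {d : ℕ} (hd : ∀ v, ∃ N : Finset V, N.card ≤ d ∧ ∀ u, H.Adj u v → u ∈ N) :
    (Finset.univ.image col).card ≤ d + 1 := by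
  have : Finset.univ.image col ⊆ Finset.Icc 1 (d + 1) := by
    intro a ha
    obtain ⟨v, -, rfl⟩ := Finset.mem_image.mp ha
    exact Finset.mem_Icc.mpr ⟨h.pos v, h.le_of_forall hd v⟩
  simpa using Finset.card_le_card this

end IsGreedyColouring

theorem square_neighbours [DecidableEq V] (G : SimpleGraph V) [DecidableRel G.Adj] (v : V) :
    ∃ N : Finset V, N.card ≤ G.maxDegree + G.maxDegree * G.maxDegree ∧
      ∀ u, (square G).Adj u v → u ∈ N := by
  refine ⟨G.neighborFinset v ∪ (G.neighborFinset v).biUnion fun w => G.neighborFinset w, ?_, ?_⟩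
  · refine (Finset.card_union_le _ _).trans (add_le_add ?_ ?_)
    · exact (G.card_neighborFinset_eq_degree v).trans_le (G.degree_le_maxDegree v)
    · refine (Finset.card_biUnion_le_card_mul _ _ G.maxDegree fun w _ => ?_).trans
        (Nat.mul_le_mul_right _ ?_)
      · exact (G.card_neighborFinset_eq_degree w).trans_le (G.degree_le_maxDegree w)
      · exact (G.card_neighborFinset_eq_degree v).trans_le (G.degree_le_maxDegree v)
  · rintro u ⟨-, h | ⟨w, h1, h2⟩⟩
    · simp [h.symm]
    · simp only [Finset.mem_union, Finset.mem_biUnion, SimpleGraph.mem_neighborFinset]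
      exact .inr ⟨w, h2.symm, h1.symm⟩

end Greedy

/-! ### The labels -/

theorem exists_isKBLabeling {V : Type*} [Fintype V] [DecidableEq V] {G : SimpleGraph V}
    [DecidableRel G.Adj] (hG : G.Connected) {k : ℕ} (s : Fin k ↪ V) (r : V) :
    ∃ lab, IsKBLabeling G s r lab := by
  classical
  obtain ⟨join, stay, ack, hack⟩ := exists_isAckLabeling hG r
  obtain ⟨sched, hsched⟩ : ∃ sched, IsSched G s sched := by
    rcases le_or_gt k G.maxDegree with hk | hk
    · refine ⟨fun v => if h : ∃ i, s i = v then Nat.bits ((h.choose : ℕ) + 1) else [false],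
        fun _ => ⟨fun i => ?_, fun v hv => ?_⟩, fun h => absurd hk (by omega)⟩
      · have h : ∃ j, s j = s i := ⟨i, rfl⟩
        dsimp only
        rw [dif_pos h, s.injective h.choose_spec]
      · dsimp only
        rw [dif_neg fun ⟨i, hi⟩ => hv i hi]
    · obtain ⟨col, hcol⟩ := exists_isGreedyColouring (square G) (Fintype.equivFin V)
      exact ⟨_, fun h => absurd hk (by omega), fun _ => ⟨_, col, hcol, fun v => rfl⟩⟩
  exact ⟨_, join, stay, ack, sched, hack, hsched, fun v => rfl⟩

theorem length_bits_le (a : ℕ) (ha : 1 ≤ a) : ((Nat.bits a).length : ℝ) ≤ 1 + Real.logb 2 a := by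
  rw [Nat.size_eq_bits_len]
  have h1 : 2 ^ (Nat.size a - 1) ≤ a := by
    have h0 : 0 < Nat.size a := Nat.size_pos.mpr ha
    exact Nat.lt_size.mp (by omega)
  have h2 : ((Nat.size a - 1 : ℕ) : ℝ) ≤ Real.logb 2 a := by
    rw [Real.le_logb_iff_rpow_le (by norm_num) (by exact_mod_cast ha), Real.rpow_natCast]
    exact_mod_cast h1
  have h3 : ((Nat.size a : ℕ) : ℝ) ≤ ((Nat.size a - 1 : ℕ) : ℝ) + 1 := by
    exact_mod_cast (by omega : Nat.size a ≤ Nat.size a - 1 + 1)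
  linarith

/-- With `P = 2 ^ (log Δ + 1) > Δ` one has `Δ ^ 2 + Δ + 2 ≤ (2 P) ^ 2`, a power of two with exponent
`2 (log Δ + 2)`. -/
theorem clog_colours_le {Δ c : ℕ} (hΔ : 1 ≤ Δ) (hc : c ≤ Δ + Δ * Δ + 1) :
    (Nat.clog 2 (c + 1) : ℝ) ≤ 4 + 2 * Real.logb 2 Δ := by
  have h1 : c + 1 ≤ 2 ^ (2 * (Nat.log 2 Δ + 2)) := by
    have h2 := Nat.lt_pow_succ_log_self (b := 2) (by norm_num) Δ
    have h3 : 2 ^ (2 * (Nat.log 2 Δ + 2)) = (2 ^ (Nat.log 2 Δ).succ * 2) ^ 2 := by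
      rw [← pow_succ, ← pow_mul]
      congr 1
      omega
    rw [h3]
    nlinarith
  have h4 : Nat.clog 2 (c + 1) ≤ 2 * (Nat.log 2 Δ + 2) := Nat.clog_le_of_le_pow h1
  have h5 : (Nat.log 2 Δ : ℝ) ≤ Real.logb 2 Δ := Real.natLog_le_logb Δ 2
  have h6 : (Nat.clog 2 (c + 1) : ℝ) ≤ 2 * (Nat.log 2 Δ + 2) := by exact_mod_cast h4
  linarith

section Labels

variable {V : Type*} [Fintype V] [DecidableEq V] {G : SimpleGraph V} [DecidableRel G.Adj]
  {k : ℕ} {s : Fin k ↪ V} {r : V}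

theorem IsKBLabeling.parse {lab : V → Bits} (h : IsKBLabeling G s r lab) :
    ∃ (join stay ack : V → Bool) (sched : V → Bits),
      IsAckLabeling G r join stay ack ∧ IsSched G s sched ∧
      (∀ v, (lab v).drop 4 = sched v) ∧ (∀ v, (lab v).length = 4 + (sched v).length) ∧
      (∀ v, (Label.parse (lab v)).strat = decide (G.maxDegree < k)) ∧
      (∀ v, (Label.parse (lab v)).sched = sched v) ∧
      ((Label.parse (lab r)).join = true ∧ (Label.parse (lab r)).stay = true ∧
        (Label.parse (lab r)).ack = true) ∧
      ∀ v, v ≠ r → (Label.parse (lab v)).join = join v ∧ (Label.parse (lab v)).stay = stay v ∧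
        (Label.parse (lab v)).ack = ack v := by
  obtain ⟨join, stay, ack, sched, h1, h2, h3⟩ := h
  refine ⟨join, stay, ack, sched, h1, h2, fun v => ?_, fun v => ?_, fun v => ?_, fun v => ?_, ?_,
    fun v hv => ?_⟩
  · rw [h3]; split_ifs <;> rfl
  · rw [h3]; split_ifs <;> simp <;> omega
  · rw [h3]; rfl
  · rw [h3]; split_ifs <;> rfl
  · rw [h3, if_pos rfl]; exact ⟨rfl, rfl, rfl⟩
  · rw [h3, if_neg hv]; exact ⟨rfl, rfl, rfl⟩

theorem isSched_length {sched : V → Bits} (hk : 1 ≤ k) (h : IsSched G s sched) (v : V) :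
    ((sched v).length : ℝ) ≤ 4 + 2 * min (Real.logb 2 k) (Real.logb 2 G.maxDegree) := by
  have hk' : (1 : ℝ) ≤ k := by exact_mod_cast hk
  have hlk : 0 ≤ Real.logb 2 k := Real.logb_nonneg (by norm_num) hk'
  rcases le_or_gt k G.maxDegree with hkd | hkd
  · obtain ⟨h1, h2⟩ := h.1 hkd
    rw [min_eq_left (Real.logb_le_logb_of_le (by norm_num) (by linarith) (by exact_mod_cast hkd))]
    by_cases hv : ∃ i, s i = v
    · obtain ⟨i, rfl⟩ := hv
      rw [h1]
      have h3 := length_bits_le ((i : ℕ) + 1) (by omega)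
      have h4 : Real.logb 2 ((i : ℕ) + 1 : ℕ) ≤ Real.logb 2 k :=
        Real.logb_le_logb_of_le (by norm_num) (by positivity) (by exact_mod_cast i.2)
      linarith
    · rw [h2 v fun i hi => hv ⟨i, hi⟩]
      simp
      linarith
  · obtain ⟨order, col, hcol, hs⟩ := h.2 hkd
    have hc := hcol.card_image_le (square_neighbours G)
    rw [hs, length_binary]
    -- For `Δ = 0` the logarithm takes its conventional value `0`; then at most one colour occurs
    -- and one bit is enough.
    rcases Nat.eq_zero_or_pos G.maxDegree with h0 | h0
    · rw [h0] at hc ⊢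
      rw [Nat.cast_zero, Real.logb_zero, min_eq_right hlk]
      have : Nat.clog 2 ((Finset.univ.image col).card + 1) ≤ 1 :=
        Nat.clog_le_of_le_pow (by simpa using hc)
      have : (Nat.clog 2 ((Finset.univ.image col).card + 1) : ℝ) ≤ 1 := by exact_mod_cast this
      linarith
    · rw [min_eq_right (Real.logb_le_logb_of_le (by norm_num) (by exact_mod_cast h0)
        (by exact_mod_cast hkd.le))]
      exact clog_colours_le h0 hc

theorem sourceMessage_source (s : Fin k ↪ V) (μ : Fin k → Bits) (i : Fin k) :
    sourceMessage s μ (s i) = some (μ i) := by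
  unfold sourceMessage
  cases h : (List.finRange k).find? (fun j => decide (s j = s i)) with
  | none =>
    have := List.find?_eq_none.mp h i (List.mem_finRange i)
    simp at this
  | some j =>
    have := List.find?_some h
    rw [s.injective (of_decide_eq_true this)]
    rfl

theorem mem_of_sourceMessage (s : Fin k ↪ V) (μ : Fin k → Bits) (v : V) (x : Bits)
    (h : sourceMessage s μ v = some x) : x ∈ Finset.univ.image μ := by
  obtain ⟨i, -, rfl⟩ := Option.map_eq_some_iff.mp h
  exact Finset.mem_image_of_mem _ (Finset.mem_univ _)

theorem IsKBLabeling.solves (hG : G.Connected) {lab : V → Bits}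
    (h : IsKBLabeling G s r lab) (μ : Fin k → Bits) (wake : V → ℕ) : Solves G KB lab s μ wake := by
  obtain ⟨join, stay, ack, sched, hack, hsched, -, -, hstrat, hsch, hr, hv⟩ := h.parse
  set l : V → Label := fun v => Label.parse (lab v) with hl
  set src := sourceMessage s μ with hsrc
  have hA := mem_of_sourceMessage s μ
  -- A single node needs no schedule: it holds every source message from the start.
  rcases subsingleton_or_nontrivial V with hV | hV
  · refine solves_of_run G lab src wake (r := r) (fun v => ?_) hsrc ⟨0, fun j _ v => ?_⟩
    · rw [Subsingleton.elim v r]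
      simp [Label.isCoordinator, hr]
    · refine (knownIn_run hA j v).known.antisymm fun x hx => ?_
      obtain ⟨i, -, rfl⟩ := Finset.mem_image.mp hx
      refine mem_known_run ?_ j
      rw [Subsingleton.elim v (s i)]
      exact sourceMessage_source s μ i
  obtain ⟨lvl, dom, par, M, z, hS⟩ := exists_schedule hG hack hr hv
  obtain ⟨T, K, hT, hK⟩ : ∃ T K, PhaseStart r .informStage 0 (2 * M + 1) (.inform K)
      (run G l src T) ∧ ∀ i, μ i ∈ K := by
    rcases le_or_gt k G.maxDegree with hkd | hkd
    · obtain ⟨h1, h2⟩ := hsched.1 hkd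
      refine hS.exists_phaseStart_inform_individual (s := s) (fun v => ?_) (fun i => ?_)
        (fun v hv => ?_) (sourceMessage_source s μ)
      · rw [hstrat]; simpa using hkd
      · rw [hsch, h1]
      · rw [hsch, h2 v hv]
    · obtain ⟨order, col, hcol, hs⟩ := hsched.2 hkd
      have hlt : ∀ v, col v < 2 ^ Nat.clog 2 ((Finset.univ.image col).card + 1) := fun v =>
        (Nat.lt_succ_of_le (hcol.le_card_image v)).trans_le (Nat.le_pow_clog (by norm_num) _)
      have hL : 0 < Nat.clog 2 ((Finset.univ.image col).card + 1) := by
        by_contra h0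
        have h1 := hlt r
        rw [Nat.eq_zero_of_not_pos h0] at h1
        have := hcol.pos r
        omega
      obtain ⟨T, K, h1, h2⟩ := hS.exists_phaseStart_inform_roundRobin (src := src)
        (fun v => by rw [hstrat]; simpa using hkd) (fun v => by rw [hsch, hs]) hL hlt hcol.pos
        (fun u v => hcol.ne_of_adj)
      exact ⟨T, K, h1, fun i => h2 _ _ (sourceMessage_source s μ i)⟩
  refine solves_of_run G lab src wake hS.coord hsrc ⟨T + (2 * M + 1), fun j hj v => ?_⟩
  refine (knownIn_run hA j v).known.antisymm fun x hx => ?_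
  obtain ⟨i, -, rfl⟩ := Finset.mem_image.mp hx
  exact hS.subset_known_of_phaseStart hA hT v hj (hK i)

end Labels

end RadioKB

theorem mainTheorem3 :
    ∃ C : ℝ, ∀ (V : Type*) [Fintype V] [DecidableEq V] (G : SimpleGraph V) [DecidableRel G.Adj],
      G.Connected → ∀ (k : ℕ), 1 ≤ k → ∀ (s : Fin k ↪ V) (r : V),
        -- the scheme produces a labeling, whatever coordinator is chosen
        (∃ lab : V → RadioKB.Bits, RadioKB.IsKBLabeling G s r lab) ∧
        ∀ lab : V → RadioKB.Bits, RadioKB.IsKBLabeling G s r lab →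
          -- the algorithm solves `k`-broadcast on the labeled network
          (∀ (μ : Fin k → RadioKB.Bits) (wake : V → ℕ),
            RadioKB.Solves G RadioKB.KB lab s μ wake) ∧
          -- the length of the scheme
          (∀ v : V, ((lab v).length : ℝ) ≤
            C * (1 + min (Real.logb 2 k) (Real.logb 2 G.maxDegree))) ∧
          -- the `sched` components are distinct IDs of the sources, or a distance-two colouring
          (k ≤ G.maxDegree → ∀ i j : Fin k, i ≠ j →
            (lab (s i)).drop 4 ≠ (lab (s j)).drop 4) ∧
          (G.maxDegree < k → ∀ u v : V, (RadioKB.square G).Adj u v →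
            (lab u).drop 4 ≠ (lab v).drop 4) := by
  -- Four leading bits and at most `4 + 2 * min` bits of `sched`, where the minimum is nonnegative,
  -- give the constant `8`.
  refine ⟨8, fun V _ _ G _ hG k hk s r => ⟨RadioKB.exists_isKBLabeling hG s r, fun lab h =>
    ⟨fun μ wake => h.solves hG μ wake, ?_⟩⟩⟩
  obtain ⟨join, stay, ack, sched, -, hsched, hdrop, hlen, -⟩ := h.parse
  refine ⟨fun v => ?_, fun hkd i j hij he => ?_, fun hkd u v huv he => ?_⟩
  · have h1 := RadioKB.isSched_length hk hsched v
    have h2 : 0 ≤ min (Real.logb 2 k) (Real.logb 2 G.maxDegree) := by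
      refine le_min (Real.logb_nonneg (by norm_num) (by exact_mod_cast hk)) ?_
      rcases Nat.eq_zero_or_pos G.maxDegree with h0 | h0
      · simp [h0]
      · exact Real.logb_nonneg (by norm_num) (by exact_mod_cast h0)
    rw [hlen]
    push_cast
    linarith
  · rw [hdrop, hdrop, (hsched.1 hkd).1, (hsched.1 hkd).1] at he
    have := RadioKB.bits_injective he
    exact hij (Fin.ext (by omega))
  · obtain ⟨order, col, hcol, hs⟩ := hsched.2 hkd
    have hlt : ∀ v, col v < 2 ^ Nat.clog 2 ((Finset.univ.image col).card + 1) := fun v =>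
      (Nat.lt_succ_of_le (hcol.le_card_image v)).trans_le (Nat.le_pow_clog (by norm_num) _)
    rw [hdrop, hdrop, hs, hs] at he
    exact hcol.ne_of_adj huv (RadioKB.binary_inj (hlt u) (hlt v) he)
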